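/- **Machine model and notation.** Programs run on a unit-cost real RAM (arrays of natural numbers and arrays of reals; natural-number addition, truncated subtraction and multiplication; real field operations and comparisons; indirect addressing by natural numbers; no conversion of reals to integers) that can flip independent fair coins. For a real tensor $T$ of order $q$ with all dimensions $n$ (written $T\in\mathbb R^{n^q}$), $\|T\|_F$ is the Frobenius norm, $\langle\cdot,\cdot\rangle$ the entrywise inner product, and $u^{\otimes q}$ has entries $u_{j_1}\cdots u_{j_q}$. Put $\widetilde O(f)=O(f\cdot(\log (f+2))^{c})$ for some constant $c$. **Lemma (Data Structure).** Let $p\ge 2$ be a fixed integer. There is a randomized data structure, given by four programs Init, Query, QueryValue, QueryRes that depend only on $p$, such that the following holds, with the constants in $O$ and $\widetilde O$ depending only on $p$, for all $n\ge 1$, $\epsilon\in(0,1)$, $\delta\in(0,1/2]$, all $A_1,\dots,A_n\in\mathbb R^{n^{p-1}}$ and all reals $D_1,\dots,D_n,D$ with $\|A_i\|_F\le D_i$ for all $i\in[n]$ and $\|A\|_F\le D$, where $A\in\mathbb R^{n^p}$ is the tensor with slices $A(i,\cdot,\dots,\cdot)=A_i$. * Init$(A_1,\dots,A_n)$ (which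 is also given $n,\epsilon,\delta$, but not the $D_i$ or $D$) preprocesses the tensors in time $\widetilde O(\epsilon^{-2}n^{p}\log(1/\delta))$. * Query$(u)$, for a unit vector $u\in\mathbb R^n$, takes time $\widetilde O(\epsilon^{-2}n^{p-1}\log(1/\delta))$ and outputs $v\in\mathbb R^n$. The output is correct if, with $t_i=\langle A_i,u^{\otimes(p-1)}\rangle$, $|v_i-t_i|\le\epsilon|t_i|+D_i\epsilon$ for all $i\in[n]$. * QueryValue$(u)$, for a unit vector $u\in\mathbb R^n$, takes time $\widetilde O(\epsilon^{-2}n^{p-1}\log(1/\delta))$ and outputs $v\in\mathbb R$. The output is correct if, with $t=\langle A,u^{\otimes p}\rangle$, $|v-t|\le\epsilon|t|+D\epsilon$. * QueryRes$(\{x_j\}_{j\in[k]},\alpha,u)$, for any $k\ge0$, $x_1,\dots,x_k\in\mathbb R^n$, $\alpha\in\mathbb R^{n\times k}$ and unit vector $u\in\mathbb R^n$, takes time $\widetilde O(\epsilon^{-2}n^{p-1}\log(1/\delta))+O(n^2k)$ and outputs $v\in\mathbb R^n$. The output is correct if, with $t_i=\langle A_i-\sum_{j=1}^k\alpha_{i,j}x_j^{\otimes(p-1)},u^{\otimes(p-1)}\rangle$,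 $|v_i-t_i|\le\epsilon|t_i|+D_i\epsilon$ for all $i\in[n]$. The time bounds hold for every outcome of the coins. All requests are robust to an adaptive adversary: whenever an adversary makes a sequence, of any length and mixing the three kinds, of requests to one initialized data structure, each chosen as an arbitrary function of all earlier requests and answers, then for every $t$ the answer to the $t$-th request is correct with probability at least $1-\delta$ over the coins of the initialization and of the requests. -/

import Mathlib

/-! ### Tensors -/

/-- A real tensor of order `q` all of whose `q` dimensions equal `n`. -/
abbrev Tensor (n q : ℕ) : Type := (Fin q → Fin n) → ℝ

namespace Tensor

/-- The entrywise inner product. -/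
def inner {n q : ℕ} (S T : Tensor n q) : ℝ := ∑ j, S j * T j

/-- The Frobenius norm. -/
noncomputable def frobenius {n q : ℕ} (T : Tensor n q) : ℝ := Real.sqrt (∑ j, T j ^ 2)

/-- The tensor power `u ⊗ ⋯ ⊗ u` with `q` factors. -/
def power {n : ℕ} (u : Fin n → ℝ) (q : ℕ) : Tensor n q := fun j => ∏ l, u (j l)

/-- The tensor of order `p` whose slices (first index fixed) are the given tensors of order
`p - 1`; the order `p = 0` is a default case. -/
def stack {n p : ℕ} (A : Fin n → Tensor n (p - 1)) : Tensor n p := fun j =>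
  if h : 0 < p then A (j ⟨0, h⟩) (fun l => j ⟨l + 1, by omega⟩) else 0

end Tensor

/-! ### A randomized real RAM

Memory consists of arrays of natural numbers and arrays of real numbers, of unbounded length.
Addresses may be computed, but only from natural numbers, and there is no conversion from real
numbers to natural numbers: real numbers can only be combined by field operations and compared.
The only source of randomness is a fair coin, and the only constants in a program are
natural-number literals. -/

/-- The memory: `nat a i` and `real a i` are the contents of cell `i` of array `a`. -/
structure Store where
  nat : ℕ → ℕ → ℕ
  real : ℕ → ℕ → ℝ

namespace Store

def setNatArray (s : Store) (a : ℕ) (f : ℕ → ℕ) : Store :=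
  { s with nat := Function.update s.nat a f }

def setRealArray (s : Store) (a : ℕ) (f : ℕ → ℝ) : Store :=
  { s with real := Function.update s.real a f }

def setNat (s : Store) (a i : ℕ) (v : ℕ) : Store :=
  s.setNatArray a (Function.update (s.nat a) i v)

def setReal (s : Store) (a i : ℕ) (v : ℝ) : Store :=
  s.setRealArray a (Function.update (s.real a) i v)

end Store

/-- Natural-number expressions. The name of an array is part of the program, the index of a cell
is computed. -/
inductive NatExp where
  | lit (c : ℕ)
  | get (a : ℕ) (i : NatExp)
  | add (e f : NatExp)
  | sub (e f : NatExp)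
  | mul (e f : NatExp)

/-- Real-number expressions. -/
inductive RealExp where
  | ofNat (e : NatExp)
  | get (a : ℕ) (i : NatExp)
  | add (e f : RealExp)
  | sub (e f : RealExp)
  | mul (e f : RealExp)
  | div (e f : RealExp)

/-- Tests. -/
inductive Test where
  | natLt (e f : NatExp)
  | realLt (e f : RealExp)

def NatExp.eval (s : Store) : NatExp → ℕ
  | lit c => c
  | get a i => s.nat a (i.eval s)
  | add e f => e.eval s + f.eval s
  | sub e f => e.eval s - f.eval s
  | mul e f => e.eval s * f.eval s

noncomputable def RealExp.eval (s : Store) : RealExp → ℝ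
  | ofNat e => (e.eval s : ℝ)
  | get a i => s.real a (i.eval s)
  | add e f => e.eval s + f.eval s
  | sub e f => e.eval s - f.eval s
  | mul e f => e.eval s * f.eval s
  | div e f => e.eval s / f.eval s

def Test.Holds (s : Store) : Test → Prop
  | natLt e f => e.eval s < f.eval s
  | realLt e f => e.eval s < f.eval s

/-- Programs. `flip a i` writes the outcome (`0` or `1`) of a fair coin to cell `i` of the
natural-number array `a`. -/
inductive Program where
  | skip
  | setNat (a : ℕ) (i : NatExp) (e : NatExp)
  | setReal (a : ℕ) (i : NatExp) (e : RealExp)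
  | flip (a : ℕ) (i : NatExp)
  | seq (c d : Program)
  | ite (b : Test) (c d : Program)
  | loop (b : Test) (c : Program)

/-- A configuration: the stack of the commands that are still to be executed, and the memory. -/
abbrev Config : Type := List Program × Store

open Classical in
/-- One step of the computation; `loop b c` is the loop `while b do c`. A step evaluates at most
two expressions of the program text, so that its cost is bounded by a constant that depends on the
program alone. A configuration with empty stack has halted. -/
noncomputable def step : Config → PMF Config
  | ([], s) => PMF.pure ([], s)
  | (.skip :: K, s) => PMF.pure (K, s)
  | (.setNat a i e :: K, s) => PMF.pure (K, s.setNat a (i.eval s) (e.eval s))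
  | (.setReal a i e :: K, s) => PMF.pure (K, s.setReal a (i.eval s) (e.eval s))
  | (.flip a i :: K, s) =>
      (PMF.uniformOfFintype Bool).map fun b => (K, s.setNat a (i.eval s) (if b then 1 else 0))
  | (.seq c d :: K, s) => PMF.pure (c :: d :: K, s)
  | (.ite b c d :: K, s) => PMF.pure (if b.Holds s then c :: K else d :: K, s)
  | (.loop b c :: K, s) => PMF.pure (if b.Holds s then c :: .loop b c :: K else K, s)

/-- The distribution of the configuration after `T` steps. -/
noncomputable def run : ℕ → Config → PMF Config
  | 0, x => PMF.pure x
  | T + 1, x => (step x).bind (run T)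

/-- Started in memory `s`, the program halts within `T` steps for every outcome of its coins. -/
def HaltsWithin (T : ℕ) (P : Program) (s : Store) : Prop :=
  ∀ x ∈ (run T ([P], s)).support, x.1 = []

/-- The distribution of the memory after at most `T` steps of the program. -/
noncomputable def execute (T : ℕ) (P : Program) (s : Store) : PMF Store :=
  (run T ([P], s)).map Prod.snd

/-! ### The data structure and its requests -/

/-- The programs of the four operations. -/
structure DataStructure where
  init : Program
  query : Program
  queryValue : Program
  queryRes : Program

/-- Unit vectors of `ℝⁿ`. -/
abbrev UnitVec (n : ℕ) : Type := {u : Fin n → ℝ // ∑ i, u i ^ 2 = 1}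

/-- The requests that the data structure answers. -/
inductive Request (n : ℕ) where
  | query (u : UnitVec n)
  | queryValue (u : UnitVec n)
  | queryRes (k : ℕ) (x : Fin k → Fin n → ℝ) (α : Fin n → Fin k → ℝ) (u : UnitVec n)

/-- The type of the answer to a request. -/
def Request.Answer {n : ℕ} : Request n → Type
  | query _ => Fin n → ℝ
  | queryValue _ => ℝ
  | queryRes _ _ _ _ => Fin n → ℝ

/-- A vector as the contents of an array. -/
def vecArray {m : ℕ} (v : Fin m → ℝ) : ℕ → ℝ := fun a => if h : a < m then v ⟨a, h⟩ else 0

/-- A matrix, row by row, as the contents of an array. -/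
def matArray {m k : ℕ} (M : Fin m → Fin k → ℝ) : ℕ → ℝ :=
  vecArray fun a : Fin (m * k) => M a.divNat a.modNat

/-- The memory on which the initialization starts: `n` in the natural-number array `0`, the entries
of the tensors in the real array `0` (the entry `j` of `A i` in the cell
`i * n ^ q + ∑ l, j l * n ^ l`), and `ε` and `δ` in the real array `1`. All other cells are `0`. -/
noncomputable def initStore {n q : ℕ} (ε δ : ℝ) (A : Fin n → Tensor n q) : Store :=
  (((Store.mk (fun _ _ => 0) (fun _ _ => 0)).setNat 0 0 n).setRealArray 0
    (matArray fun i r => A i (finFunctionFinEquiv.symm r))).setRealArray 1 (vecArray ![ε, δ])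

namespace Request

/-- Puts the input of a request into memory: `u` into the real array `2`, and, for `queryRes`,
`k` into cell `0` of the natural-number array `1`, the vectors `x j` into the real array `3` and
the matrix `α` into the real array `4`. -/
noncomputable def load {n : ℕ} (s : Store) : Request n → Store
  | query u => s.setRealArray 2 (vecArray u.1)
  | queryValue u => s.setRealArray 2 (vecArray u.1)
  | queryRes k x α u =>
      (((s.setNat 1 0 k).setRealArray 2 (vecArray u.1)).setRealArray 3 (matArray x)).setRealArray 4
        (matArray α)

/-- Reads the answer off the real array `5`. -/
def read {n : ℕ} (s : Store) : (r : Request n) → r.Answer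
  | query _ => fun i : Fin n => s.real 5 i
  | queryValue _ => s.real 5 0
  | queryRes _ _ _ _ => fun i : Fin n => s.real 5 i

/-- The program that serves a request. -/
def program {n : ℕ} (ds : DataStructure) : Request n → Program
  | query _ => ds.query
  | queryValue _ => ds.queryValue
  | queryRes _ _ _ _ => ds.queryRes

end Request

/-- The number `v` agrees with `t` up to a multiplicative error `1 ± ε` and an additive error
`ε * D`. -/
def Approx (ε D t v : ℝ) : Prop := |v - t| ≤ ε * |t| + D * ε

/-- What a correct answer to a request is, for the tensors `A i` and their stack. -/
def Request.Correct {n p : ℕ} (A : Fin n → Tensor n (p - 1)) (D : Fin n → ℝ) (Dtot ε : ℝ) :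
    (r : Request n) → r.Answer → Prop
  | query u => fun v : Fin n → ℝ =>
      ∀ i, Approx ε (D i) ((A i).inner (Tensor.power u.1 (p - 1))) (v i)
  | queryValue u => fun v : ℝ =>
      Approx ε Dtot ((Tensor.stack A).inner (Tensor.power u.1 p)) v
  | queryRes k x α u => fun v : Fin n → ℝ =>
      ∀ i, Approx ε (D i)
        (Tensor.inner (A i - ∑ j : Fin k, α i j • Tensor.power (x j) (p - 1))
          (Tensor.power u.1 (p - 1))) (v i)

/-! ### Running times -/

/-- `C · f · (log f) ^ c`, with `f + 2` in the logarithm, so that it stays away from `0`. -/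
noncomputable def softBound (C : ℝ) (c : ℕ) (f : ℝ) : ℝ := C * f * Real.log (f + 2) ^ c

/-- The number of steps allowed to the initialization. -/
noncomputable def initTime (C : ℝ) (c p n : ℕ) (ε δ : ℝ) : ℕ :=
  ⌊softBound C c (ε⁻¹ ^ 2 * (n : ℝ) ^ p * Real.log (1 / δ))⌋₊

/-- The number of steps allowed to each kind of request. -/
noncomputable def Request.time {n : ℕ} (C : ℝ) (c p : ℕ) (ε δ : ℝ) : Request n → ℕ
  | query _ => ⌊softBound C c (ε⁻¹ ^ 2 * (n : ℝ) ^ (p - 1) * Real.log (1 / δ))⌋₊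
  | queryValue _ => ⌊softBound C c (ε⁻¹ ^ 2 * (n : ℝ) ^ (p - 1) * Real.log (1 / δ))⌋₊
  | queryRes k _ _ _ =>
      ⌊softBound C c (ε⁻¹ ^ 2 * (n : ℝ) ^ (p - 1) * Real.log (1 / δ))
        + C * ((n : ℝ) ^ 2 * (k : ℝ))⌋₊

/-! ### Adaptive adversaries -/

/-- The requests made so far, with the answers given, in order. -/
abbrev Transcript (n : ℕ) : Type := List (Σ r : Request n, r.Answer)

/-- An adaptive adversary: it chooses each request on the basis of all earlier answers. -/
abbrev Adversary (n : ℕ) : Type := Transcript n → Request n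

/-- The joint distribution of the transcript and the memory after `t` requests of the adversary,
when the initialization is allowed `Tinit` steps and a request `r` is allowed `T r` steps. Memory
persists between requests, and the coins of different operations are independent. -/
noncomputable def play {n q : ℕ} (ds : DataStructure) (ε δ : ℝ) (A : Fin n → Tensor n q)
    (Tinit : ℕ) (T : Request n → ℕ) (adv : Adversary n) : ℕ → PMF (Transcript n × Store)
  | 0 => (execute Tinit ds.init (initStore ε δ A)).map fun s => ([], s)
  | t + 1 => (play ds ε δ A Tinit T adv t).bind fun z =>
      (execute (T (adv z.1)) ((adv z.1).program ds) ((adv z.1).load z.2)).map fun s =>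
        (z.1 ++ [⟨adv z.1, (adv z.1).read s⟩], s)

/-- The event that the most recent answer is wrong. -/
def lastWrong {n p : ℕ} (A : Fin n → Tensor n (p - 1)) (D : Fin n → ℝ) (Dtot ε : ℝ) :
    Set (Transcript n × Store) :=
  {z | ∃ a ∈ z.1.getLast?, ¬ a.1.Correct A D Dtot ε a.2}

/-!
The data structure needs no preprocessing beyond the squared norms of the tensors and a few sizes,
because `⟨A i, u ⊗ ⋯ ⊗ u⟩` can be estimated by sampling multi-indices `J` from the product
distribution `∏ l, u (J l) ^ 2` given by the *query*. The ratio `A i J / ∏ l, u (J l)` is an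
unbiased estimator with second moment at most `‖A i‖ ^ 2`, so about `ε⁻² log (n / δ)` samples
suffice, and the same samples serve all `n` tensors. Every request tosses fresh coins, so an
adaptive adversary gains nothing: on every memory that the initialization or earlier requests can
leave behind (`Ready`), the answer is wrong with probability at most `δ` (`run_request`), and
`play_correct` lifts this to sequences of requests.

Two points need care. First, the ratios are unbounded. They are replaced by `0` when they exceed
`‖A i‖ / e`, where `e = ε / 5`; by the second moment this changes the expectation by at most
`e ‖A i‖`, and it makes the exponential moment method work for the plain mean, with the right dependence
on `δ` (`card_chernoff`, `card_estimate_bad_le`). Second, with finitely many coins the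
distribution `u j ^ 2` can only be approximated: `B` coins give a point of a grid of step
`2 ^ (-B)`, and the coordinate is the cell of the partial sums of `u j ^ 2` in which this point lies.
Since the truncated estimator is bounded, a total variation error of at most `e ^ 2` is harmless
(`abs_sum_picks_sub_le`), and `B = O(log (n / ε))` coins achieve it.

The value of `A` itself is the inner product of `u` with the estimates, by the Cauchy-Schwarz
inequality; the low-rank part of a residual is evaluated exactly through
`⟨x ⊗ ⋯ ⊗ x, u ⊗ ⋯ ⊗ u⟩ = ⟨x, u⟩ ^ (p - 1)`.

On the machine, a request first tosses all its coins and then runs deterministically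
(`run_flipCoins_seq`), so that the programs are verified in a Hoare logic with time bounds for
deterministic runs (`Terminates`), while the probabilities are counted over the cube of coins.
-/

/-! ### A program logic for the RAM -/

namespace Store

@[simp] theorem setNat_nat (s : Store) (a i v b j : ℕ) :
    (s.setNat a i v).nat b j = if b = a ∧ j = i then v else s.nat b j := by
  by_cases h : b = a
  · subst h
    by_cases h' : j = i <;> simp [setNat, setNatArray, h']
  · simp [setNat, setNatArray, h]

@[simp] theorem setNat_real (s : Store) (a i v : ℕ) : (s.setNat a i v).real = s.real := rfl

@[simp] theorem setReal_real (s : Store) (a i : ℕ) (v : ℝ) (b j : ℕ) :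
    (s.setReal a i v).real b j = if b = a ∧ j = i then v else s.real b j := by
  by_cases h : b = a
  · subst h
    by_cases h' : j = i <;> simp [setReal, setRealArray, h']
  · simp [setReal, setRealArray, h]

@[simp] theorem setReal_nat (s : Store) (a i : ℕ) (v : ℝ) : (s.setReal a i v).nat = s.nat := rfl

theorem setNat_nat_of_ne (s : Store) {a b : ℕ} (i v : ℕ) (h : b ≠ a) :
    (s.setNat a i v).nat b = s.nat b := by
  simp [setNat, setNatArray, h]

theorem setReal_real_of_ne (s : Store) {a b : ℕ} (i : ℕ) (v : ℝ) (h : b ≠ a) :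
    (s.setReal a i v).real b = s.real b := by
  simp [setReal, setRealArray, h]

end Store

namespace Program

/-- Whether the program text contains a write access to the natural-number array `a`. -/
def writesNat (a : ℕ) : Program → Bool
  | skip => false
  | setNat b _ _ => a == b
  | setReal _ _ _ => false
  | flip b _ => a == b
  | seq c d => c.writesNat a || d.writesNat a
  | ite _ c d => c.writesNat a || d.writesNat a
  | loop _ c => c.writesNat a

/-- Whether the program text contains a write access to the real array `a`. -/
def writesReal (a : ℕ) : Program → Bool
  | skip => false
  | setNat _ _ _ => false
  | setReal b _ _ => a == b
  | flip _ _ => false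
  | seq c d => c.writesReal a || d.writesReal a
  | ite _ c d => c.writesReal a || d.writesReal a
  | loop _ c => c.writesReal a

end Program

theorem mem_support_step_nat {x y : Config} (h : y ∈ (step x).support) (a : ℕ)
    (hx : ∀ P ∈ x.1, P.writesNat a = false) :
    (∀ P ∈ y.1, P.writesNat a = false) ∧ y.2.nat a = x.2.nat a := by
  obtain ⟨_ | ⟨P, K⟩, s⟩ := x
  · simp only [step, PMF.support_pure, Set.mem_singleton_iff] at h
    subst h; simp
  · simp only [List.mem_cons, forall_eq_or_imp] at hx
    obtain ⟨hP, hK⟩ := hx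
    cases P with
    | skip =>
      simp only [step, PMF.support_pure, Set.mem_singleton_iff] at h
      subst h; exact ⟨hK, rfl⟩
    | setNat b i e =>
      simp only [step, PMF.support_pure, Set.mem_singleton_iff] at h
      subst h
      exact ⟨hK, Store.setNat_nat_of_ne _ _ _ (by simpa [Program.writesNat] using hP)⟩
    | setReal b i e =>
      simp only [step, PMF.support_pure, Set.mem_singleton_iff] at h
      subst h; exact ⟨hK, rfl⟩
    | flip b i =>
      simp only [step, PMF.support_map, Set.mem_image] at h
      obtain ⟨v, -, rfl⟩ := h
      exact ⟨hK, Store.setNat_nat_of_ne _ _ _ (by simpa [Program.writesNat] using hP)⟩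
    | seq c d =>
      simp only [step, PMF.support_pure, Set.mem_singleton_iff] at h
      subst h
      simp only [Program.writesNat, Bool.or_eq_false_iff] at hP
      simpa [hP] using hK
    | ite b c d =>
      simp only [step, PMF.support_pure, Set.mem_singleton_iff] at h
      subst h
      simp only [Program.writesNat, Bool.or_eq_false_iff] at hP
      split_ifs <;> simpa [hP] using hK
    | loop b c =>
      simp only [step, PMF.support_pure, Set.mem_singleton_iff] at h
      subst h
      simp only [Program.writesNat] at hP
      split_ifs <;> simpa [hP, Program.writesNat] using hK

theorem mem_support_step_real {x y : Config} (h : y ∈ (step x).support) (a : ℕ)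
    (hx : ∀ P ∈ x.1, P.writesReal a = false) :
    (∀ P ∈ y.1, P.writesReal a = false) ∧ y.2.real a = x.2.real a := by
  obtain ⟨_ | ⟨P, K⟩, s⟩ := x
  · simp only [step, PMF.support_pure, Set.mem_singleton_iff] at h
    subst h; simp
  · simp only [List.mem_cons, forall_eq_or_imp] at hx
    obtain ⟨hP, hK⟩ := hx
    cases P with
    | skip =>
      simp only [step, PMF.support_pure, Set.mem_singleton_iff] at h
      subst h; exact ⟨hK, rfl⟩
    | setReal b i e =>
      simp only [step, PMF.support_pure, Set.mem_singleton_iff] at h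
      subst h
      exact ⟨hK, Store.setReal_real_of_ne _ _ _ (by simpa [Program.writesReal] using hP)⟩
    | setNat b i e =>
      simp only [step, PMF.support_pure, Set.mem_singleton_iff] at h
      subst h; exact ⟨hK, rfl⟩
    | flip b i =>
      simp only [step, PMF.support_map, Set.mem_image] at h
      obtain ⟨v, -, rfl⟩ := h
      exact ⟨hK, rfl⟩
    | seq c d =>
      simp only [step, PMF.support_pure, Set.mem_singleton_iff] at h
      subst h
      simp only [Program.writesReal, Bool.or_eq_false_iff] at hP
      simpa [hP] using hK
    | ite b c d =>
      simp only [step, PMF.support_pure, Set.mem_singleton_iff] at h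
      subst h
      simp only [Program.writesReal, Bool.or_eq_false_iff] at hP
      split_ifs <;> simpa [hP] using hK
    | loop b c =>
      simp only [step, PMF.support_pure, Set.mem_singleton_iff] at h
      subst h
      simp only [Program.writesReal] at hP
      split_ifs <;> simpa [hP, Program.writesReal] using hK

theorem mem_support_run_nat {T : ℕ} {x y : Config} (h : y ∈ (run T x).support) (a : ℕ)
    (hx : ∀ P ∈ x.1, P.writesNat a = false) : y.2.nat a = x.2.nat a := by
  induction T generalizing x with
  | zero =>
    simp only [run, PMF.support_pure, Set.mem_singleton_iff] at h
    rw [h]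
  | succ T ih =>
    simp only [run, PMF.mem_support_bind_iff] at h
    obtain ⟨z, hz, hy⟩ := h
    have := mem_support_step_nat hz a hx
    rw [ih hy this.1, this.2]

theorem mem_support_run_real {T : ℕ} {x y : Config} (h : y ∈ (run T x).support) (a : ℕ)
    (hx : ∀ P ∈ x.1, P.writesReal a = false) : y.2.real a = x.2.real a := by
  induction T generalizing x with
  | zero =>
    simp only [run, PMF.support_pure, Set.mem_singleton_iff] at h
    rw [h]
  | succ T ih =>
    simp only [run, PMF.mem_support_bind_iff] at h
    obtain ⟨z, hz, hy⟩ := h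
    have := mem_support_step_real hz a hx
    rw [ih hy this.1, this.2]

/-- The memories `s` and `s'` agree on all arrays that `P` does not write to. -/
def Program.Frame (P : Program) (s s' : Store) : Prop :=
  (∀ a, P.writesNat a = false → s'.nat a = s.nat a) ∧
    ∀ a, P.writesReal a = false → s'.real a = s.real a

/-- Total correctness with a time bound, for a run that uses no coins: from the memory `s`, the
program `P` comes to an end within `t` steps, in a memory that satisfies `Q`. The continuation `K`
makes this notion compose. -/
def Terminates (P : Program) (s : Store) (t : ℕ) (Q : Store → Prop) : Prop :=
  ∃ s', Q s' ∧ ∃ T ≤ t, ∀ K N, run (T + N) (P :: K, s) = run N (K, s')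

theorem run_succ_of_step {x y : Config} (h : step x = PMF.pure y) (T : ℕ) :
    run (T + 1) x = run T y := by
  rw [run, h, PMF.pure_bind]

theorem run_nil (T : ℕ) (s : Store) : run T ([], s) = PMF.pure ([], s) := by
  induction T with
  | zero => rfl
  | succ T ih => rw [run_succ_of_step rfl, ih]

namespace Terminates

variable {P c d : Program} {s : Store} {t t' : ℕ} {Q Q' : Store → Prop}

theorem mono (h : Terminates P s t Q) (ht : t ≤ t') (hQ : ∀ s', Q s' → Q' s') :
    Terminates P s t' Q' := by
  obtain ⟨s', h1, T, h2, h3⟩ := h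
  exact ⟨s', hQ _ h1, T, h2.trans ht, h3⟩

theorem of_le (ht : t ≤ t') (h : Terminates P s t Q) : Terminates P s t' Q :=
  h.mono ht fun _ => id

/-- Arrays that the program does not mention as targets keep their contents. -/
theorem frame (h : Terminates P s t Q) : Terminates P s t fun s' => Q s' ∧ P.Frame s s' := by
  obtain ⟨s', h1, T, h2, h3⟩ := h
  have h4 : (([], s') : Config) ∈ (run T ([P], s)).support := by
    have := h3 [] 0
    rw [Nat.add_zero] at this
    rw [this]
    simp [run]
  refine ⟨s', ⟨h1, fun a ha => ?_, fun a ha => ?_⟩, T, h2, h3⟩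
  · exact mem_support_run_nat h4 a (by simpa using ha)
  · exact mem_support_run_real h4 a (by simpa using ha)

theorem of_step (h : ∀ K, step (P :: K, s) = PMF.pure (K, s')) (hQ : Q s') :
    Terminates P s 1 Q :=
  ⟨s', hQ, 1, le_rfl, fun K N => by rw [Nat.add_comm, run_succ_of_step (h K)]⟩

theorem skip (h : Q s) : Terminates .skip s 1 Q :=
  of_step (fun _ => rfl) h

theorem setNat {a : ℕ} {i e : NatExp} (h : Q (s.setNat a (i.eval s) (e.eval s))) :
    Terminates (.setNat a i e) s 1 Q :=
  of_step (fun _ => rfl) h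

theorem setReal {a : ℕ} {i : NatExp} {e : RealExp} (h : Q (s.setReal a (i.eval s) (e.eval s))) :
    Terminates (.setReal a i e) s 1 Q :=
  of_step (fun _ => rfl) h

theorem seq (h : Terminates c s t fun s' => Terminates d s' t' Q) :
    Terminates (.seq c d) s (t + t' + 1) Q := by
  obtain ⟨s', ⟨s'', hQ, T', hT', h'⟩, T, hT, h⟩ := h
  refine ⟨s'', hQ, T + T' + 1, by omega, fun K N => ?_⟩
  rw [show T + T' + 1 + N = (T + (T' + N)) + 1 by omega,
    run_succ_of_step (y := (c :: d :: K, s)) rfl, h, h']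

theorem ite {b : Test} (h : b.Holds s → Terminates c s t Q)
    (h' : ¬ b.Holds s → Terminates d s t Q) : Terminates (.ite b c d) s (t + 1) Q := by
  by_cases hb : b.Holds s
  · obtain ⟨s', hQ, T, hT, h⟩ := h hb
    refine ⟨s', hQ, T + 1, by omega, fun K N => ?_⟩
    rw [show T + 1 + N = (T + N) + 1 by omega,
      run_succ_of_step (y := (c :: K, s)) (by simp [step, hb]), h]
  · obtain ⟨s', hQ, T, hT, h⟩ := h' hb
    refine ⟨s', hQ, T + 1, by omega, fun K N => ?_⟩
    rw [show T + 1 + N = (T + N) + 1 by omega,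
      run_succ_of_step (y := (d :: K, s)) (by simp [step, hb]), h]

/-- A loop whose number `n` of iterations is known in advance. -/
theorem loop {b : Test} (n : ℕ) (I : ℕ → Store → Prop) (h0 : I 0 s)
    (hstep : ∀ i < n, ∀ s', c.Frame s s' → I i s' →
      b.Holds s' ∧ Terminates c s' t (I (i + 1)))
    (hend : ∀ s', c.Frame s s' → I n s' → ¬ b.Holds s' ∧ Q s') :
    Terminates (.loop b c) s (n * (t + 1) + 1) Q := by
  have key : ∀ r i s', i + r = n → c.Frame s s' → I i s' →
      Terminates (.loop b c) s' (r * (t + 1) + 1) Q := by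
    intro r
    induction r with
    | zero =>
      intro i s' hi hF hI
      obtain rfl : i = n := by omega
      obtain ⟨hb, hQ⟩ := hend s' hF hI
      exact (of_step (fun K => by simp [step, hb]) hQ).mono (by omega) fun _ => id
    | succ r ih =>
      intro i s' hi hF hI
      obtain ⟨hb, hc⟩ := hstep i (by omega) s' hF hI
      obtain ⟨s1, ⟨hI1, hF1⟩, T1, hT1, h1⟩ := hc.frame
      obtain ⟨s2, hQ, T2, hT2, h2⟩ := ih (i + 1) s1 (by omega)
        ⟨fun a ha => (hF1.1 a ha).trans (hF.1 a ha),
          fun a ha => (hF1.2 a ha).trans (hF.2 a ha)⟩ hI1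
      refine ⟨s2, hQ, T1 + T2 + 1, by rw [Nat.add_mul]; omega, fun K N => ?_⟩
      rw [show T1 + T2 + 1 + N = (T1 + (T2 + N)) + 1 by omega,
        run_succ_of_step (y := (c :: .loop b c :: K, s')) (by simp [step, hb]), h1, h2]
  exact key n 0 s (by omega) ⟨fun _ _ => rfl, fun _ _ => rfl⟩ h0

end Terminates

/-- `for a < e do c`, with the loop counter in cell `0` of the natural-number array `a`. -/
def Program.for (a : ℕ) (e : NatExp) (c : Program) : Program :=
  .seq (.setNat a (.lit 0) (.lit 0))
    (.loop (.natLt (.get a (.lit 0)) e)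
      (.seq c (.setNat a (.lit 0) (.add (.get a (.lit 0)) (.lit 1)))))

/-- The rule for a `for` loop. The body may be analysed under the assumption that all arrays that
the loop does not write to are as they were at the beginning. -/
theorem Terminates.for {a : ℕ} {e : NatExp} {c : Program} {s : Store} {t : ℕ} {Q : Store → Prop}
    (n : ℕ) (I : ℕ → Store → Prop) (ha : c.writesNat a = false)
    (he : ∀ s', (Program.for a e c).Frame s s' → e.eval s' = n)
    (h0 : I 0 (s.setNat a 0 0))
    (hstep : ∀ i < n, ∀ s', (Program.for a e c).Frame s s' → s'.nat a 0 = i → I i s' →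
      Terminates c s' t fun s'' => I (i + 1) (s''.setNat a 0 (i + 1)))
    (hend : ∀ s', (Program.for a e c).Frame s s' → I n s' → Q s') :
    Terminates (.for a e c) s (n * (t + 3) + 3) Q := by
  have hfr : ∀ s', (Program.seq c (.setNat a (.lit 0)
      (.add (.get a (.lit 0)) (.lit 1)))).Frame (s.setNat a 0 0) s' →
      (Program.for a e c).Frame s s' := by
    intro s' h
    refine ⟨fun b hb => ?_, fun b hb => ?_⟩
    · simp only [Program.for, Program.writesNat, Bool.or_eq_false_iff] at hb
      rw [h.1 b (by simp [Program.writesNat, hb])]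
      exact Store.setNat_nat_of_ne _ _ _ (by simpa using hb.1)
    · simp only [Program.for, Program.writesReal, Bool.or_eq_false_iff] at hb
      rw [h.2 b (by simp [Program.writesReal, hb])]
      rfl
  have hloop : Terminates (.loop (.natLt (.get a (.lit 0)) e)
      (.seq c (.setNat a (.lit 0) (.add (.get a (.lit 0)) (.lit 1))))) (s.setNat a 0 0)
      (n * (t + 1 + 1 + 1) + 1) Q := by
    refine Terminates.loop n (fun i s' => s'.nat a 0 = i ∧ I i s') ⟨by simp, h0⟩ ?_ ?_
    · rintro i hi s' hF ⟨hc, hI⟩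
      refine ⟨?_, Terminates.seq ?_⟩
      · simpa [Test.Holds, NatExp.eval, hc, he s' (hfr s' hF)] using hi
      · refine ((hstep i hi s' (hfr s' hF) hc hI).frame).mono le_rfl ?_
        rintro s'' ⟨hI', hF'⟩
        refine Terminates.setNat ?_
        have : s''.nat a 0 = i := by rw [hF'.1 a ha, hc]
        simpa [NatExp.eval, this] using hI'
    · rintro s' hF ⟨hc, hI⟩
      refine ⟨?_, hend s' (hfr s' hF) hI⟩
      simp [Test.Holds, NatExp.eval, hc, he s' (hfr s' hF)]
  have hall : Terminates (.for a e c) s (1 + (n * (t + 1 + 1 + 1) + 1) + 1) Q :=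
    Terminates.seq (Terminates.setNat hloop)
  exact hall.mono (by rw [show t + 1 + 1 + 1 = t + 3 by omega]; omega) fun _ => id

/-! ### Tossing the coins -/

/-- Writes independent fair coins to the cells `0, …, e - 1` of the natural-number array `5`. -/
def flipCoins (e : NatExp) : Program :=
  .seq (.setNat 6 (.lit 0) (.lit 0))
    (.loop (.natLt (.get 6 (.lit 0)) e)
      (.seq (.flip 5 (.get 6 (.lit 0))) (.setNat 6 (.lit 0) (.add (.get 6 (.lit 0)) (.lit 1)))))

theorem uniformOfFintype_bool_succ (k : ℕ) :
    PMF.uniformOfFintype (Fin (k + 1) → Bool) =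
      (PMF.uniformOfFintype Bool).bind fun x =>
        (PMF.uniformOfFintype (Fin k → Bool)).map fun b => (Fin.cons x b : Fin (k + 1) → Bool) := by
  ext b
  have h : ∀ (x : Bool) (b' : Fin k → Bool),
      (b = (Fin.cons x b' : Fin (k + 1) → Bool)) ↔ (x = b 0 ∧ b' = Fin.tail b) := by
    intro x b'
    constructor
    · rintro rfl; simp
    · rintro ⟨rfl, rfl⟩; simp
  simp only [PMF.bind_apply, PMF.map_apply, PMF.uniformOfFintype_apply, tsum_fintype, h]
  rw [Finset.sum_eq_single (b 0), Finset.sum_eq_single (Fin.tail b)]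
  · simp [pow_succ, ENNReal.mul_inv, mul_comm]
  · intro b' _ hb'; simp [hb']
  · simp
  · intro x _ hx; simp [hx]
  · simp

/-- The effect of the remaining `k` rounds of the loop of `flipCoins`. -/
theorem run_flip_loop (e : NatExp) (M : ℕ) (k : ℕ) : ∀ (c : ℕ) (s : Store), c + k = M →
    s.nat 6 0 = c →
    (∀ s' : Store, (∀ a, a ≠ 5 → a ≠ 6 → s'.nat a = s.nat a) → e.eval s' = M) →
    ∃ out : (Fin k → Bool) → Store,
      (∀ K N, run (4 * k + 1 + N) (.loop (.natLt (.get 6 (.lit 0)) e)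
          (.seq (.flip 5 (.get 6 (.lit 0)))
            (.setNat 6 (.lit 0) (.add (.get 6 (.lit 0)) (.lit 1)))) :: K, s) =
        (PMF.uniformOfFintype (Fin k → Bool)).bind fun b => run N (K, out b)) ∧
      ∀ b, (∀ i : Fin k, (out b).nat 5 (c + i) = if b i then 1 else 0) ∧
        (∀ j < c, (out b).nat 5 j = s.nat 5 j) ∧
        (∀ a, a ≠ 5 → a ≠ 6 → (out b).nat a = s.nat a) ∧ (out b).real = s.real := by
  induction k with
  | zero =>
    intro c s hc h6 he
    refine ⟨fun _ => s, fun K N => ?_, fun b => ⟨fun i => i.elim0, fun _ _ => rfl,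
      fun _ _ _ => rfl, rfl⟩⟩
    have hb : ¬ (Test.natLt (.get 6 (.lit 0)) e).Holds s := by
      simp [Test.Holds, NatExp.eval, h6, he s fun _ _ _ => rfl, ← hc]
    rw [show 4 * 0 + 1 + N = N + 1 by omega, run_succ_of_step (y := (K, s)) (by simp [step, hb]),
      PMF.bind_const]
  | succ k ih =>
    intro c s hc h6 he
    have hb : (Test.natLt (.get 6 (.lit 0)) e).Holds s := by
      simp [Test.Holds, NatExp.eval, h6, he s fun _ _ _ => rfl]; omega
    let s1 : Bool → Store := fun x => (s.setNat 5 c (if x then 1 else 0)).setNat 6 0 (c + 1)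
    have hs1 : ∀ x a, a ≠ 5 → a ≠ 6 → (s1 x).nat a = s.nat a := by
      intro x a h5 h6
      simp only [s1]
      rw [Store.setNat_nat_of_ne _ _ _ h6, Store.setNat_nat_of_ne _ _ _ h5]
    choose out hrun hout using fun x : Bool => ih (c + 1) (s1 x) (by omega) (by simp [s1])
      fun s' h => he s' fun a h5 h6 => (h a h5 h6).trans (hs1 x a h5 h6)
    refine ⟨fun b => out (b 0) (Fin.tail b), fun K N => ?_, fun b => ?_⟩
    · rw [show 4 * (k + 1) + 1 + N = (4 * k + 1 + N + 1 + 1) + 1 + 1 by omega,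
        run_succ_of_step (by simp only [step, hb, if_true]; rfl), run_succ_of_step rfl, run]
      simp only [step, PMF.bind_map, uniformOfFintype_bool_succ, PMF.bind_bind]
      congr 1
      funext x
      simp only [Function.comp_apply, NatExp.eval, h6]
      rw [run_succ_of_step rfl]
      simpa [Function.comp_def, NatExp.eval, s1, h6] using hrun x K N
    · obtain ⟨h1, h2, h3, h4⟩ := hout (b 0) (Fin.tail b)
      refine ⟨fun i => ?_, fun j hj => ?_, fun a h5 h6 => (h3 a h5 h6).trans (hs1 _ a h5 h6), h4⟩
      · show (out (b 0) (Fin.tail b)).nat 5 (c + i) = _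
        refine Fin.cases ?_ (fun i => ?_) i
        · exact (h2 c (by omega)).trans (by simp [s1])
        · have := h1 i
          rw [Fin.val_succ, show c + (i + 1 : ℕ) = c + 1 + i by omega, this]
          rfl
      · show (out (b 0) (Fin.tail b)).nat 5 j = _
        rw [h2 j (by omega)]
        simp [s1, hj.ne]

theorem run_flipCoins (e : NatExp) (M : ℕ) (s : Store)
    (he : ∀ s' : Store, (∀ a, a ≠ 5 → a ≠ 6 → s'.nat a = s.nat a) → e.eval s' = M) :
    ∃ out : (Fin M → Bool) → Store,
      (∀ K N, run (4 * M + 3 + N) (flipCoins e :: K, s) =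
        (PMF.uniformOfFintype (Fin M → Bool)).bind fun b => run N (K, out b)) ∧
      ∀ b, (∀ i : Fin M, (out b).nat 5 i = if b i then 1 else 0) ∧
        (∀ a, a ≠ 5 → a ≠ 6 → (out b).nat a = s.nat a) ∧ (out b).real = s.real := by
  have hs : ∀ a, a ≠ 5 → a ≠ 6 → (s.setNat 6 0 0).nat a = s.nat a :=
    fun a _ h6 => Store.setNat_nat_of_ne _ _ _ h6
  obtain ⟨out, hrun, hout⟩ := run_flip_loop e M M 0 (s.setNat 6 0 0) (by omega) (by simp)
    fun s' h => he s' fun a h5 h6 => (h a h5 h6).trans (hs a h5 h6)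
  refine ⟨out, fun K N => ?_, fun b => ?_⟩
  · rw [show 4 * M + 3 + N = (4 * M + 1 + N) + 1 + 1 by omega, flipCoins,
      run_succ_of_step rfl, run_succ_of_step rfl]
    exact hrun K N
  · obtain ⟨h1, -, h3, h4⟩ := hout b
    exact ⟨fun i => by simpa using h1 i, fun a h5 h6 => (h3 a h5 h6).trans (hs a h5 h6), h4⟩

/-- A program that first tosses `M` coins and then runs without coins. -/
theorem run_flipCoins_seq {e : NatExp} {M : ℕ} {s : Store} {P : Program} {t : ℕ}
    {Q : (Fin M → Bool) → Store → Prop}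
    (he : ∀ s' : Store, (∀ a, a ≠ 5 → a ≠ 6 → s'.nat a = s.nat a) → e.eval s' = M)
    (hP : ∀ (b : Fin M → Bool) (s' : Store), (∀ i : Fin M, s'.nat 5 i = if b i then 1 else 0) →
      (∀ a, a ≠ 5 → a ≠ 6 → s'.nat a = s.nat a) → s'.real = s.real →
      Terminates P s' t (Q b)) :
    ∃ out : (Fin M → Bool) → Store, (∀ b, Q b (out b)) ∧
      ∀ T, 4 * M + t + 4 ≤ T → run T ([.seq (flipCoins e) P], s) =
        (PMF.uniformOfFintype (Fin M → Bool)).map fun b => ([], out b) := by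
  obtain ⟨out, hrun, hout⟩ := run_flipCoins e M s he
  choose out' hQ T' hT' hrun' using fun b => hP b (out b) (hout b).1 (hout b).2.1 (hout b).2.2
  refine ⟨out', hQ, fun T hT => ?_⟩
  obtain ⟨N, rfl⟩ : ∃ N, T = (4 * M + 3 + (t + N)) + 1 := ⟨T - (4 * M + t + 4), by omega⟩
  rw [run_succ_of_step rfl, hrun, PMF.map]
  congr 1
  funext b
  obtain ⟨N', hN'⟩ : ∃ N', t + N = T' b + N' := ⟨t + N - T' b, by have := hT' b; omega⟩
  rw [hN', hrun', run_nil]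
  rfl

/-! ### Sampling from a vector of squares with finitely many coins -/

/-- `J` is the cell of the partition of `[0, 1)` into intervals of lengths `w 0, w 1, …` that
contains `r`. -/
def Picks (w : ℕ → ℝ) (r : ℝ) (J : ℕ) : Prop :=
  ∑ j ∈ Finset.range J, w j ≤ r ∧ r < ∑ j ∈ Finset.range (J + 1), w j

theorem Picks.unique {w : ℕ → ℝ} (hw : ∀ j, 0 ≤ w j) {r : ℝ} {J J' : ℕ} (h : Picks w r J)
    (h' : Picks w r J') : J = J' := by
  have hm : Monotone fun k => ∑ j ∈ Finset.range k, w j := fun a b hab =>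
    Finset.sum_le_sum_of_subset_of_nonneg (Finset.range_mono hab) fun _ _ _ => hw _
  by_contra hne
  rcases Nat.lt_or_gt_of_ne hne with hlt | hlt
  · have := hm (show J + 1 ≤ J' from hlt)
    linarith [h.2, h'.1]
  · have := hm (show J' + 1 ≤ J from hlt)
    linarith [h'.2, h.1]

theorem exists_picks {w : ℕ → ℝ} {n : ℕ} {r : ℝ} (hr : 0 ≤ r)
    (hrn : r < ∑ j ∈ Finset.range n, w j) : ∃ J < n, Picks w r J := by
  classical
  have hex : ∃ k, r < ∑ j ∈ Finset.range k, w j := ⟨n, hrn⟩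
  have h0 : Nat.find hex ≠ 0 := by
    intro h
    have := Nat.find_spec hex
    rw [h] at this
    simp at this
    linarith
  obtain ⟨J, hJ⟩ := Nat.exists_eq_succ_of_ne_zero h0
  have hle : Nat.find hex ≤ n := Nat.find_min' hex hrn
  refine ⟨J, by omega, ?_, ?_⟩
  · have := Nat.find_min hex (m := J) (by omega)
    linarith
  · have := Nat.find_spec hex
    rwa [hJ] at this

/-- Of the `N` equally spaced points `R / N`, the fraction that lies in the cell `j` differs from
the length `w j` by at most `1 / N`. -/
theorem abs_card_picks_sub_le {w : ℕ → ℝ} (hw : ∀ j, 0 ≤ w j) {n N : ℕ} (hN : 0 < N)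
    (hsum : ∑ j ∈ Finset.range n, w j = 1) {j : ℕ} (hj : j < n)
    [DecidablePred fun R : Fin N => Picks w ((R : ℝ) / N) j] :
    |((Finset.univ.filter fun R : Fin N => Picks w ((R : ℝ) / N) j).card : ℝ) / N - w j|
      ≤ 1 / N := by
  have hN' : (0 : ℝ) < N := by exact_mod_cast hN
  have hm : Monotone fun k => ∑ j ∈ Finset.range k, w j := fun a b hab =>
    Finset.sum_le_sum_of_subset_of_nonneg (Finset.range_mono hab) fun _ _ _ => hw _
  set x := ∑ i ∈ Finset.range j, w i with hx
  set y := ∑ i ∈ Finset.range (j + 1), w i with hy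
  have hx0 : 0 ≤ x := Finset.sum_nonneg fun _ _ => hw _
  have hy1 : y ≤ 1 := by rw [← hsum]; exact hm hj
  have hxy : y = x + w j := Finset.sum_range_succ _ _
  have hwj := hw j
  have hcard : ((Finset.univ.filter fun R : Fin N => Picks w ((R : ℝ) / N) j).map
      Fin.valEmbedding) = Finset.Ico ⌈x * N⌉₊ ⌈y * N⌉₊ := by
    ext R
    simp only [Finset.mem_map, Finset.mem_filter, Finset.mem_univ, true_and, Finset.mem_Ico,
      Fin.valEmbedding_apply, Nat.ceil_le, Nat.lt_ceil, Picks, ← hx, ← hy]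
    constructor
    · rintro ⟨R, ⟨h1, h2⟩, rfl⟩
      exact ⟨(le_div_iff₀ hN').1 h1, (div_lt_iff₀ hN').1 h2⟩
    · rintro ⟨h1, h2⟩
      have hR : R < N := by
        have : (R : ℝ) < N := by nlinarith
        exact_mod_cast this
      exact ⟨⟨R, hR⟩, ⟨(le_div_iff₀ hN').2 h1, (div_lt_iff₀ hN').2 h2⟩, rfl⟩
  have hle : ⌈x * N⌉₊ ≤ ⌈y * N⌉₊ := Nat.ceil_mono (by nlinarith)
  have hc : ((Finset.univ.filter fun R : Fin N => Picks w ((R : ℝ) / N) j).card : ℝ)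
      = ⌈y * N⌉₊ - ⌈x * N⌉₊ := by
    rw [← Finset.card_map Fin.valEmbedding, hcard, Nat.card_Ico, Nat.cast_sub hle]
  have h1 := Nat.le_ceil (x * N)
  have h2 := Nat.ceil_lt_add_one (show 0 ≤ x * N by positivity)
  have h3 := Nat.le_ceil (y * N)
  have h4 := Nat.ceil_lt_add_one (show 0 ≤ y * N by nlinarith)
  rw [hc, abs_le]
  constructor
  · rw [neg_le_sub_iff_le_add, ← sub_le_iff_le_add, sub_le_iff_le_add, ← add_div, le_div_iff₀ hN']
    nlinarith
  · rw [sub_le_iff_le_add, div_le_iff₀ hN', add_mul, one_div, inv_mul_cancel₀ hN'.ne']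
    nlinarith

theorem sum_prod_eq_one {n q : ℕ} {a : Fin n → ℝ} (ha : ∑ j, a j = 1) :
    ∑ J : Fin q → Fin n, ∏ l, a (J l) = 1 := by
  rw [← Fintype.sum_pow, ha, one_pow]

/-- Subadditivity of the total variation distance of product distributions. -/
theorem sum_abs_prod_sub_prod_le {n : ℕ} {a w : Fin n → ℝ} (ha : ∀ j, 0 ≤ a j)
    (hw : ∀ j, 0 ≤ w j) (ha1 : ∑ j, a j = 1) (hw1 : ∑ j, w j = 1) (q : ℕ) :
    ∑ J : Fin q → Fin n, |∏ l, a (J l) - ∏ l, w (J l)| ≤ q * ∑ j, |a j - w j| := by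
  induction q with
  | zero => simp
  | succ q ih =>
    rw [← (Fin.consEquiv fun _ => Fin n).sum_comp, Fintype.sum_prod_type]
    simp only [Fin.consEquiv_apply, Fin.prod_univ_succ, Fin.cons_zero, Fin.cons_succ]
    have hle : ∀ (x : Fin n) (J : Fin q → Fin n),
        |a x * ∏ l, a (J l) - w x * ∏ l, w (J l)| ≤
          a x * |∏ l, a (J l) - ∏ l, w (J l)| + |a x - w x| * ∏ l, w (J l) := by
      intro x J
      have hp : 0 ≤ ∏ l, w (J l) := Finset.prod_nonneg fun _ _ => hw _
      calc |a x * ∏ l, a (J l) - w x * ∏ l, w (J l)|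
          = |a x * (∏ l, a (J l) - ∏ l, w (J l)) + (a x - w x) * ∏ l, w (J l)| := by ring_nf
        _ ≤ _ := by
            refine (abs_add_le _ _).trans ?_
            rw [abs_mul, abs_mul, abs_of_nonneg (ha x), abs_of_nonneg hp]
    calc ∑ x, ∑ J : Fin q → Fin n, |a x * ∏ l, a (J l) - w x * ∏ l, w (J l)|
        ≤ ∑ x, ∑ J : Fin q → Fin n,
          (a x * |∏ l, a (J l) - ∏ l, w (J l)| + |a x - w x| * ∏ l, w (J l)) :=
          Finset.sum_le_sum fun x _ => Finset.sum_le_sum fun J _ => hle x J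
      _ = (∑ J : Fin q → Fin n, |∏ l, a (J l) - ∏ l, w (J l)|) + ∑ j, |a j - w j| := by
          simp only [Finset.sum_add_distrib, ← Finset.mul_sum, ← Finset.sum_mul]
          rw [ha1, sum_prod_eq_one hw1, one_mul]
          simp
      _ ≤ _ := by push_cast; linarith

/-- The average over finely discretized samples of a function of independent picks is close to
its exact expectation. -/
theorem abs_sum_picks_sub_le {n N q : ℕ} (hN : 0 < N) {w : ℕ → ℝ} (hw : ∀ j, 0 ≤ w j)
    (hsum : ∑ j ∈ Finset.range n, w j = 1) {pick : Fin N → Fin n}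
    (hpick : ∀ R : Fin N, Picks w ((R : ℝ) / N) (pick R)) {g : (Fin q → Fin n) → ℝ} {G : ℝ}
    (hg : ∀ J, |g J| ≤ G) :
    |(∑ R : Fin q → Fin N, g fun l => pick (R l)) / (N : ℝ) ^ q
      - ∑ J : Fin q → Fin n, (∏ l, w (J l)) * g J| ≤ G * (q * n / N) := by
  classical
  have hN' : (0 : ℝ) < N := by exact_mod_cast hN
  let c : Fin n → ℕ := fun j => (Finset.univ.filter fun R : Fin N => pick R = j).card
  have hc : ∀ j : Fin n, |(c j : ℝ) / N - w j| ≤ 1 / N := by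
    intro j
    rw [← show (Finset.univ.filter fun R : Fin N => Picks w ((R : ℝ) / N) j).card = c j from ?_]
    · exact abs_card_picks_sub_le hw hN hsum j.2
    · congr 1
      ext R
      simp only [Finset.mem_filter, Finset.mem_univ, true_and]
      exact ⟨fun h => Fin.ext ((hpick R).unique hw h), fun h => h ▸ hpick R⟩
  have hc1 : ∑ j, (c j : ℝ) / N = 1 := by
    rw [← Finset.sum_div, div_eq_one_iff_eq hN'.ne']
    have := Finset.card_eq_sum_card_fiberwise (f := pick) (s := Finset.univ) (t := Finset.univ)
      (fun _ _ => Finset.mem_coe.2 (Finset.mem_univ _))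
    rw [Finset.card_univ, Fintype.card_fin] at this
    exact_mod_cast this.symm
  have hw1 : ∑ j : Fin n, w j = 1 := by rw [Fin.sum_univ_eq_sum_range, hsum]
  have hfib : (∑ R : Fin q → Fin N, g fun l => pick (R l)) / (N : ℝ) ^ q
      = ∑ J : Fin q → Fin n, (∏ l, ((c (J l) : ℝ) / N)) * g J := by
    rw [← Finset.sum_fiberwise (s := Finset.univ) (g := fun (R : Fin q → Fin N) l => pick (R l)),
      Finset.sum_div]
    refine Finset.sum_congr rfl fun J _ => ?_
    have hcardJ : (Finset.univ.filter fun R : Fin q → Fin N => (fun l => pick (R l)) = J).card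
        = ∏ l, c (J l) := by
      rw [← Fintype.card_piFinset]
      congr 1
      ext R
      simp [Fintype.mem_piFinset, funext_iff]
    rw [Finset.sum_congr rfl (g := fun _ => g J), Finset.sum_const, hcardJ, nsmul_eq_mul,
      Finset.prod_div_distrib, Finset.prod_const, Finset.card_univ, Fintype.card_fin]
    · push_cast; ring
    · intro R hR
      rw [(Finset.mem_filter.1 hR).2]
  rw [hfib, ← Finset.sum_sub_distrib]
  have hG : 0 ≤ G ∨ IsEmpty (Fin q → Fin n) := by
    by_cases h : Nonempty (Fin q → Fin n)
    · exact Or.inl ((abs_nonneg _).trans (hg h.some))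
    · exact Or.inr (not_nonempty_iff.1 h)
  have htv := sum_abs_prod_sub_prod_le (a := fun j => (c j : ℝ) / N) (w := fun j : Fin n => w j)
    (fun j => by positivity) (fun j => hw j) hc1 hw1 q
  have hd : ∑ j : Fin n, |(c j : ℝ) / N - w j| ≤ n / N := by
    refine (Finset.sum_le_sum fun j _ => hc j).trans ?_
    simp [div_eq_mul_inv]
  rcases hG with hG | hG
  · calc |∑ J : Fin q → Fin n, ((∏ l, ((c (J l) : ℝ) / N)) * g J - (∏ l, w (J l)) * g J)|
        ≤ ∑ J : Fin q → Fin n, |(∏ l, ((c (J l) : ℝ) / N)) * g J - (∏ l, w (J l)) * g J| :=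
          Finset.abs_sum_le_sum_abs _ _
      _ ≤ ∑ J : Fin q → Fin n, G * |(∏ l, ((c (J l) : ℝ) / N)) - ∏ l, w (J l)| := by
          refine Finset.sum_le_sum fun J _ => ?_
          rw [← sub_mul, abs_mul, mul_comm]
          exact mul_le_mul_of_nonneg_right (hg J) (abs_nonneg _)
      _ = G * ∑ J : Fin q → Fin n, |(∏ l, ((c (J l) : ℝ) / N)) - ∏ l, w (J l)| := by
          rw [Finset.mul_sum]
      _ ≤ G * (q * n / N) := by
          refine mul_le_mul_of_nonneg_left (htv.trans ?_) hG
          rw [mul_div_assoc]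
          exact mul_le_mul_of_nonneg_left hd (Nat.cast_nonneg q)
  · have hq : q ≠ 0 := by
      rintro rfl
      exact hG.elim finZeroElim
    have hn : n = 0 := by
      rw [isEmpty_fun] at hG
      by_contra hn
      exact hG.2.elim ⟨0, Nat.pos_of_ne_zero hn⟩
    subst hn
    simp at hsum

/-! ### The concentration inequality -/

/-- Chernoff's method for the sum of `m` independent uniform samples of a function bounded by `1`
with mean `μ` and second moment at most `v`. -/
theorem card_chernoff {V : Type*} [Fintype V] [Nonempty V] (f : V → ℝ) (hf : ∀ x, |f x| ≤ 1)
    {μ v : ℝ} (hμ : ∑ x, f x = μ * Fintype.card V) (hv : ∑ x, f x ^ 2 ≤ v * Fintype.card V)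
    (m : ℕ) (a : ℝ) :
    ({R : Fin m → V | m * (μ + a) ≤ ∑ τ, f (R τ)}.ncard : ℝ)
      ≤ Real.exp (m * (v - a)) * (Fintype.card V : ℝ) ^ m := by
  classical
  rw [Set.ncard_eq_toFinset_card', Set.toFinset_ofPred]
  have hexp : ∀ x, Real.exp (f x) ≤ 1 + f x + f x ^ 2 := by
    intro x
    have := (abs_le.1 (Real.abs_exp_sub_one_sub_id_le (hf x))).2
    linarith
  have hV : (0 : ℝ) < Fintype.card V := by exact_mod_cast Fintype.card_pos
  have hmgf : ∑ x, Real.exp (f x) ≤ Real.exp (μ + v) * Fintype.card V := by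
    calc ∑ x, Real.exp (f x) ≤ ∑ x, (1 + f x + f x ^ 2) := Finset.sum_le_sum fun x _ => hexp x
      _ = Fintype.card V + ∑ x, f x + ∑ x, f x ^ 2 := by
          simp [Finset.sum_add_distrib]
      _ ≤ (μ + v + 1) * Fintype.card V := by rw [hμ]; linarith
      _ ≤ _ := mul_le_mul_of_nonneg_right (Real.add_one_le_exp _) hV.le
  have hsum : ∑ R : Fin m → V, Real.exp (∑ τ, f (R τ)) = (∑ x, Real.exp (f x)) ^ m := by
    rw [Fintype.sum_pow]
    exact Finset.sum_congr rfl fun R _ => Real.exp_sum _ _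
  have hmark : ((Finset.univ.filter fun R : Fin m → V =>
      m * (μ + a) ≤ ∑ τ, f (R τ)).card : ℝ) * Real.exp (m * (μ + a))
      ≤ ∑ R : Fin m → V, Real.exp (∑ τ, f (R τ)) := by
    rw [← nsmul_eq_mul]
    refine (Finset.card_nsmul_le_sum _ (fun R : Fin m → V => Real.exp (∑ τ, f (R τ))) _ ?_).trans
      (Finset.sum_le_sum_of_subset_of_nonneg (Finset.subset_univ _)
        fun _ _ _ => (Real.exp_pos _).le)
    intro R hR
    exact Real.exp_le_exp.2 (Finset.mem_filter.1 hR).2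
  have hpow : (∑ x, Real.exp (f x)) ^ m ≤ (Real.exp (μ + v) * Fintype.card V) ^ m :=
    pow_le_pow_left₀ (Finset.sum_nonneg fun _ _ => (Real.exp_pos _).le) hmgf m
  rw [hsum] at hmark
  have h := hmark.trans hpow
  rw [mul_pow, ← Real.exp_nat_mul] at h
  have he : Real.exp (m * (μ + v)) = Real.exp (m * (v - a)) * Real.exp (m * (μ + a)) := by
    rw [← Real.exp_add]; congr 1; ring
  rw [he, mul_right_comm] at h
  exact le_of_mul_le_mul_right h (Real.exp_pos _)

/-! ### The truncated importance-sampling estimator -/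

/-- The contribution `a / x` of a sample, cut off to `0` when it is larger than `√S / e` in absolute
value. For `x = 0` it is `0`; such samples have weight `0` in the exact distribution. -/
noncomputable def truncatedRatio (S e a x : ℝ) : ℝ :=
  if S < (a / x) ^ 2 * e ^ 2 then 0 else a / x

section Estimator

variable {n q N : ℕ} {A : Tensor n q} {u : Fin n → ℝ} {e : ℝ}

theorem abs_truncatedRatio_le {S a x : ℝ} (he : 0 < e) :
    |truncatedRatio S e a x| ≤ √S / e := by
  unfold truncatedRatio
  split_ifs with h
  · simpa using by positivity
  · rw [le_div_iff₀ he]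
    refine Real.le_sqrt_of_sq_le ?_
    rw [mul_pow, sq_abs]
    exact not_lt.1 h

theorem sum_weight_mul_truncatedRatio_sq_le (S : ℝ) :
    ∑ J : Fin q → Fin n, (∏ l, u (J l) ^ 2) * truncatedRatio S e (A J) (∏ l, u (J l)) ^ 2
      ≤ ∑ J, A J ^ 2 := by
  refine Finset.sum_le_sum fun J _ => ?_
  rw [Finset.prod_pow, truncatedRatio]
  split_ifs
  · simpa using sq_nonneg (A J)
  · by_cases hx : ∏ l, u (J l) = 0
    · simpa [hx] using sq_nonneg (A J)
    · rw [← mul_pow, mul_div_cancel₀ _ hx]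

/-- The truncation moves the expectation of the estimator by at most `e √S`. -/
theorem abs_sum_weight_mul_truncatedRatio_sub_le (he : 0 < e)
    (hS : 0 < ∑ J, A J ^ 2) :
    |∑ J : Fin q → Fin n, (∏ l, u (J l) ^ 2) *
        truncatedRatio (∑ J, A J ^ 2) e (A J) (∏ l, u (J l)) - A.inner (Tensor.power u q)|
      ≤ e * √(∑ J, A J ^ 2) := by
  set S := ∑ J, A J ^ 2 with hSdef
  have hs : 0 < √S := Real.sqrt_pos.2 hS
  have hss : √S * √S = S := Real.mul_self_sqrt hS.le
  unfold Tensor.inner Tensor.power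
  rw [← Finset.sum_sub_distrib]
  have hterm : ∀ J : Fin q → Fin n, |(∏ l, u (J l) ^ 2) *
      truncatedRatio S e (A J) (∏ l, u (J l)) - A J * ∏ l, u (J l)| ≤ e / √S * A J ^ 2 := by
    intro J
    have hnn : 0 ≤ e / √S * A J ^ 2 := by positivity
    rw [Finset.prod_pow]
    set x := ∏ l, u (J l)
    by_cases hx : x = 0
    · simpa [hx] using hnn
    unfold truncatedRatio
    split_ifs with h
    -- A large ratio `|A J / x| > √S / e` makes the dropped term `A J * x` small.
    · have h1 : √S ≤ |A J / x| * e := by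
        refine (Real.sqrt_le_sqrt h.le).trans ?_
        rw [← mul_pow, Real.sqrt_sq_eq_abs, abs_mul, abs_of_pos he]
      have hx' : 0 < |x| := abs_pos.2 hx
      rw [mul_zero, zero_sub, abs_neg, abs_mul, ← sq_abs (A J)]
      rw [abs_div, div_mul_eq_mul_div, le_div_iff₀ hx'] at h1
      rw [div_mul_eq_mul_div, le_div_iff₀ hs]
      nlinarith [abs_nonneg (A J)]
    · have : x ^ 2 * (A J / x) = A J * x := by field_simp
      rw [this, sub_self, abs_zero]
      exact hnn
  calc _ ≤ ∑ J : Fin q → Fin n, |(∏ l, u (J l) ^ 2) *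
        truncatedRatio S e (A J) (∏ l, u (J l)) - A J * ∏ l, u (J l)| :=
        Finset.abs_sum_le_sum_abs _ _
    _ ≤ ∑ J : Fin q → Fin n, e / √S * A J ^ 2 := Finset.sum_le_sum fun J _ => hterm J
    _ = e / √S * (√S * √S) := by rw [← Finset.mul_sum, hss]
    _ = e * √S := by field_simp

/-- The mean of `m` truncated samples misses `⟨A, u ⊗ ⋯ ⊗ u⟩` by more than `5 e ‖A‖` with
probability at most `2 exp (- m e²)`. -/
theorem card_estimate_bad_le (he : 0 < e) (hu : ∑ i, u i ^ 2 = 1) {w : ℕ → ℝ}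
    (hw : ∀ j, 0 ≤ w j) (hwu : ∀ j : Fin n, w j = u j ^ 2) (hN : 0 < N)
    (hNe : (q : ℝ) * n ≤ N * e ^ 2) {pick : Fin N → Fin n}
    (hpick : ∀ R : Fin N, Picks w ((R : ℝ) / N) (pick R)) {m : ℕ} (hm : 0 < m) :
    ({R : Fin m → Fin q → Fin N | 5 * e * A.frobenius <
      |(∑ τ, truncatedRatio (∑ J, A J ^ 2) e (A fun l => pick (R τ l))
        (∏ l, u (pick (R τ l)))) / m - A.inner (Tensor.power u q)|}.ncard : ℝ)
      ≤ 2 * Real.exp (-(m * e ^ 2)) * ((N : ℝ) ^ q) ^ m := by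
  unfold Tensor.frobenius
  set S := ∑ J, A J ^ 2 with hSdef
  set t := A.inner (Tensor.power u q) with ht
  have hm' : (0 : ℝ) < m := by exact_mod_cast hm
  have hN' : (0 : ℝ) < N := by exact_mod_cast hN
  have hS0 : 0 ≤ S := Finset.sum_nonneg fun _ _ => sq_nonneg _
  have hVq : (0 : ℝ) < (N : ℝ) ^ q := by positivity
  rcases hS0.eq_or_lt with hS | hS
  · -- The zero tensor: every sample vanishes.
    have hA : ∀ J, A J = 0 := by
      intro J
      have := (Finset.sum_eq_zero_iff_of_nonneg fun J _ => sq_nonneg (A J)).1 hS.symm J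
        (Finset.mem_univ J)
      exact pow_eq_zero_iff two_ne_zero |>.1 this
    have ht0 : t = 0 := by simp [ht, Tensor.inner, hA]
    have : ∀ x : ℝ, truncatedRatio 0 e 0 x = 0 := by simp [truncatedRatio]
    simp only [← hS, hA, this, ht0, Real.sqrt_zero]
    simp only [mul_zero, Finset.sum_const_zero, zero_div, sub_zero, abs_zero, lt_irrefl,
      Set.ofPred_false, Set.ncard_empty, Nat.cast_zero]
    positivity
  have hs : 0 < √S := Real.sqrt_pos.2 hS
  have hss : √S ^ 2 = S := Real.sq_sqrt hS0
  have : Nonempty (Fin q → Fin N) := ⟨fun _ => ⟨0, hN⟩⟩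
  have hcard : (Fintype.card (Fin q → Fin N) : ℝ) = (N : ℝ) ^ q := by simp
  let g : (Fin q → Fin n) → ℝ := fun J => truncatedRatio S e (A J) (∏ l, u (J l))
  let X : (Fin q → Fin N) → ℝ := fun R => g fun l => pick (R l)
  have hg : ∀ J, |g J| ≤ √S / e := fun J => abs_truncatedRatio_le he
  have hsum : ∑ j ∈ Finset.range n, w j = 1 := by
    rw [← Fin.sum_univ_eq_sum_range, ← hu]
    exact Finset.sum_congr rfl fun j _ => hwu j
  have hη : (q * n / N : ℝ) ≤ e ^ 2 := by
    rw [div_le_iff₀ hN']; linarith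
  set E := (∑ R, X R) / (N : ℝ) ^ q with hE
  have hmean : |E - t| ≤ 2 * e * √S := by
    have h1 := abs_sum_picks_sub_le (q := q) hN hw hsum hpick hg
    simp only [hwu] at h1
    have h2 := abs_sum_weight_mul_truncatedRatio_sub_le (u := u) he hS
    have h3 : √S / e * (q * n / N) ≤ e * √S := by
      calc √S / e * (q * n / N) ≤ √S / e * e ^ 2 := mul_le_mul_of_nonneg_left hη (by positivity)
        _ = e * √S := by field_simp
    calc |E - t| ≤ _ := abs_sub_le _ _ _
      _ ≤ e * √S + e * √S := add_le_add (h1.trans h3) h2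
      _ = _ := by ring
  have hsecond : (∑ R, X R ^ 2) ≤ 2 * S * (N : ℝ) ^ q := by
    have hg2 : ∀ J, |g J ^ 2| ≤ S / e ^ 2 := by
      intro J
      rw [abs_pow]
      calc |g J| ^ 2 ≤ (√S / e) ^ 2 := pow_le_pow_left₀ (abs_nonneg _) (hg J) 2
        _ = S / e ^ 2 := by rw [div_pow, hss]
    have h1 := (abs_le.1 (abs_sum_picks_sub_le (q := q) hN hw hsum hpick hg2)).2
    simp only [hwu] at h1
    have h2 := sum_weight_mul_truncatedRatio_sq_le (A := A) (u := u) (e := e) S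
    have h3 : S / e ^ 2 * (q * n / N) ≤ S := by
      calc S / e ^ 2 * (q * n / N) ≤ S / e ^ 2 * e ^ 2 :=
            mul_le_mul_of_nonneg_left hη (by positivity)
        _ = S := by field_simp
    rw [← div_le_iff₀ hVq]
    have h4 := h1.trans h3
    rw [sub_le_iff_le_add] at h4
    exact h4.trans (by linarith)
  -- The samples are scaled so as to be bounded by `1`; both tails are estimated separately.
  have htail : ∀ c : ℝ, |c| = 1 →
      ({R : Fin m → Fin q → Fin N |
        m * (c * e / √S * E + 3 * e ^ 2) ≤ ∑ τ, c * e / √S * X (R τ)}.ncard : ℝ)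
      ≤ Real.exp (-(m * e ^ 2)) * ((N : ℝ) ^ q) ^ m := by
    intro c hc
    have hc2 : c ^ 2 = 1 := by rw [← sq_abs, hc, one_pow]
    have := card_chernoff (fun R => c * e / √S * X R) (μ := c * e / √S * E) (v := 2 * e ^ 2)
      (fun R => by
        rw [abs_mul, abs_div, abs_mul, hc, one_mul, abs_of_pos he, abs_of_pos hs]
        calc e / √S * |X R| ≤ e / √S * (√S / e) :=
              mul_le_mul_of_nonneg_left (hg _) (by positivity)
          _ = 1 := by field_simp)
      (by rw [← Finset.mul_sum, hcard, hE]; field_simp)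
      (by
        simp only [mul_pow, ← Finset.mul_sum, hcard]
        rw [div_pow, mul_pow, hc2, hss, one_mul]
        calc e ^ 2 / S * ∑ R, X R ^ 2 ≤ e ^ 2 / S * (2 * S * (N : ℝ) ^ q) :=
              mul_le_mul_of_nonneg_left hsecond (by positivity)
          _ = _ := by field_simp)
      m (3 * e ^ 2)
    rw [hcard] at this
    refine this.trans (le_of_eq ?_)
    congr 2
    ring
  have hsub : {R : Fin m → Fin q → Fin N | 5 * e * √S <
      |(∑ τ, truncatedRatio S e (A fun l => pick (R τ l)) (∏ l, u (pick (R τ l)))) / m - t|} ⊆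
      {R : Fin m → Fin q → Fin N |
        m * (1 * e / √S * E + 3 * e ^ 2) ≤ ∑ τ, 1 * e / √S * X (R τ)} ∪
      {R : Fin m → Fin q → Fin N |
        m * (-1 * e / √S * E + 3 * e ^ 2) ≤ ∑ τ, -1 * e / √S * X (R τ)} := by
    intro R hR
    have hR : 5 * e * √S < |(∑ τ, X (R τ)) / m - t| := hR
    set Y := ∑ τ, X (R τ) with hY
    have h5 : 3 * e * √S < |Y / m - E| := by
      have := abs_sub_le (Y / m) E t
      linarith
    simp only [Set.mem_union, Set.mem_ofPred_eq, ← Finset.mul_sum, ← hY]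
    have hkey : ∀ c : ℝ, 3 * e * √S ≤ c * (Y / m - E) →
        m * (c * e / √S * E + 3 * e ^ 2) ≤ c * e / √S * Y := by
      intro c h
      have h6 := mul_le_mul_of_nonneg_left h (show 0 ≤ m * e / √S by positivity)
      have h7 : m * e / √S * (3 * e * √S) = m * (3 * e ^ 2) := by field_simp
      have h8 : m * e / √S * (c * (Y / m - E)) = c * e / √S * Y - m * (c * e / √S * E) := by
        field_simp
      rw [h7, h8] at h6
      linarith
    rcases le_abs.1 h5.le with h | h
    · exact Or.inl (hkey 1 (by linarith))
    · exact Or.inr (hkey (-1) (by linarith))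
  have h := (Set.ncard_le_ncard hsub (Set.toFinite _)).trans (Set.ncard_union_le _ _)
  have h' := htail 1 (by simp)
  have h'' := htail (-1) (by simp)
  have h3 := (Nat.cast_le (α := ℝ)).2 h
  rw [Nat.cast_add] at h3
  linarith

end Estimator

/-! ### The programs -/

/-! Arrays besides those of the input and output: of natural numbers, `2` number of samples, `3` coins
per coordinate, `4` scratch, `5` coins, `6` number of coins tossed so far, `7` sampled coordinates,
`8` and `9` loop counters; of reals, `6` squared norms, `7` and `8` scratch. -/

/-- The `k`-th power of an expression, for a fixed `k`, by repeated multiplication. -/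
def NatExp.pow (e : NatExp) : ℕ → NatExp
  | 0 => .lit 1
  | k + 1 => .mul (NatExp.pow e k) e

@[simp] theorem NatExp.eval_pow (s : Store) (e : NatExp) (k : ℕ) :
    (NatExp.pow e k).eval s = e.eval s ^ k := by
  induction k with
  | zero => rfl
  | succ k ih => simp [NatExp.pow, NatExp.eval, ih, _root_.pow_succ]

/-- The `k`-th power of an expression, for a fixed `k`, by repeated multiplication. -/
def RealExp.pow (e : RealExp) : ℕ → RealExp
  | 0 => .ofNat (.lit 1)
  | k + 1 => .mul (RealExp.pow e k) e

@[simp] theorem RealExp.eval_pow (s : Store) (e : RealExp) (k : ℕ) :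
    (RealExp.pow e k).eval s = e.eval s ^ k := by
  induction k with
  | zero => simp [RealExp.pow, RealExp.eval, NatExp.eval]
  | succ k ih => simp [RealExp.pow, RealExp.eval, ih, _root_.pow_succ]

attribute [simp] NatExp.eval RealExp.eval

/-- Cell `0` of a natural-number array, used as a variable. -/
abbrev natVar (a : ℕ) : NatExp := .get a (.lit 0)

/-- Cell `0` of a real array, used as a variable. -/
abbrev realVar (a : ℕ) : RealExp := .get a (.lit 0)

/-- The internal precision `e = ε / 5`; the total error of an estimate is `5 * e` times the norm. -/
abbrev precision : RealExp := .div (realVar 1) (.ofNat (.lit 5))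

/-- Stores the squared norms of the tensors in the real array `6`. -/
def computeNorms (q : ℕ) : Program :=
  .for 8 (natVar 0) (.seq (.setReal 7 (.lit 0) (.ofNat (.lit 0)))
    (.seq (.for 9 (.pow (natVar 0) q)
        (.setReal 7 (.lit 0) (.add (realVar 7) (.pow (.get 0
          (.add (.mul (natVar 8) (.pow (natVar 0) q)) (natVar 9))) 2))))
      (.setReal 6 (natVar 8) (realVar 7))))

/-- Doubles the real `y` until it is at least `e`; the number of rounds is put into the
natural-number array `a`. -/
def countDoublings (a : ℕ) (y e : RealExp) : Program :=
  .seq (.setNat a (.lit 0) (.lit 0)) (.seq (.setReal 7 (.lit 0) y)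
    (.loop (.realLt (realVar 7) e) (.seq (.setReal 7 (.lit 0) (.add (realVar 7) (realVar 7)))
      (.setNat a (.lit 0) (.add (natVar a) (.lit 1))))))

/-- With `K` the number in the natural-number array `4` and `e` the internal precision, puts the
least `m` with `K ≤ m * e ^ 2` into the array `2`. -/
def countSamples : Program :=
  .seq (.setNat 2 (.lit 0) (.lit 0))
    (.loop (.realLt (.mul (.ofNat (natVar 2)) (.pow precision 2)) (.ofNat (natVar 4)))
      (.setNat 2 (.lit 0) (.add (natVar 2) (.lit 1))))

/-- The initialization: squared norms in the real array `6`, the number of samples in the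
natural-number array `2`, and the number of coins per sampled coordinate in the array `3`. -/
def initProgram (q : ℕ) : Program :=
  .seq (computeNorms q)
    (.seq (countDoublings 4 (.get 1 (.lit 1)) (.ofNat (.mul (.lit 2) (natVar 0))))
      (.seq countSamples
        (countDoublings 3 (.pow precision 2) (.ofNat (.mul (.lit q) (natVar 0))))))

/-- Turns each block of coins into a number in `[0, 1)` and that number into a coordinate, by a
linear scan of the partial sums of the squares of `u`. The sampled coordinates go to the
natural-number array `7`. -/
def drawSamples (q : ℕ) : Program :=
  .for 8 (.mul (natVar 2) (.lit q))
    (.seq (.setReal 8 (.lit 0) (.ofNat (.lit 0)))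
    (.seq (.for 9 (natVar 3) (.setReal 8 (.lit 0) (.div
        (.add (realVar 8) (.ofNat (.get 5 (.add (.mul (natVar 8) (natVar 3)) (natVar 9)))))
        (.ofNat (.lit 2)))))
    (.seq (.setReal 7 (.lit 0) (.ofNat (.lit 0)))
    (.seq (.setNat 7 (natVar 8) (.lit 0))
      (.for 9 (natVar 0) (.seq (.setReal 7 (.lit 0) (.add (realVar 7) (.pow (.get 2 (natVar 9)) 2)))
        (.ite (.realLt (realVar 8) (realVar 7)) .skip
          (.setNat 7 (natVar 8) (.add (natVar 9) (.lit 1))))))))))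

/-- The coordinate number `l` of the sample whose number is in the counter `9`. -/
abbrev sampleExp (q l : ℕ) : NatExp := .get 7 (.add (.mul (natVar 9) (.lit q)) (.lit l))

/-- The position inside a tensor of the entry that a sample refers to, from the first `k`
coordinates. -/
def offsetExp (q : ℕ) : ℕ → NatExp
  | 0 => .lit 0
  | k + 1 => .add (offsetExp q k) (.mul (sampleExp q k) (.pow (natVar 0) k))

/-- The product of the entries of `u` that a sample refers to, over the first `k` coordinates. -/
def weightExp (q : ℕ) : ℕ → RealExp
  | 0 => .ofNat (.lit 1)
  | k + 1 => .mul (weightExp q k) (.get 2 (sampleExp q k))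

@[simp] theorem eval_offsetExp (s : Store) (q k : ℕ) : (offsetExp q k).eval s =
    ∑ l ∈ Finset.range k, s.nat 7 (s.nat 9 0 * q + l) * s.nat 0 0 ^ l := by
  induction k with
  | zero => rfl
  | succ k ih => simp [offsetExp, ih, Finset.sum_range_succ]

@[simp] theorem eval_weightExp (s : Store) (q k : ℕ) : (weightExp q k).eval s =
    ∏ l ∈ Finset.range k, s.real 2 (s.nat 7 (s.nat 9 0 * q + l)) := by
  induction k with
  | zero => simp [weightExp]
  | succ k ih => simp [weightExp, ih, Finset.prod_range_succ]

/-- Averages, for every tensor, the truncated ratios over all samples; the results go to the real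
array `5`. -/
def computeMeans (q : ℕ) : Program :=
  .for 8 (natVar 0) (.seq (.setReal 7 (.lit 0) (.ofNat (.lit 0)))
    (.seq (.for 9 (natVar 2)
        (.seq (.setReal 8 (.lit 0) (.div
            (.get 0 (.add (.mul (natVar 8) (.pow (natVar 0) q)) (offsetExp q q)))
            (weightExp q q)))
          (.ite (.realLt (.get 6 (natVar 8)) (.mul (.pow (realVar 8) 2) (.pow precision 2)))
            .skip (.setReal 7 (.lit 0) (.add (realVar 7) (realVar 8))))))
      (.setReal 5 (natVar 8) (.div (realVar 7) (.ofNat (natVar 2))))))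

/-- Replaces the estimates in the real array `5` by their inner product with `u`. -/
def combineValue : Program :=
  .seq (.setReal 7 (.lit 0) (.ofNat (.lit 0)))
    (.seq (.for 8 (natVar 0) (.setReal 7 (.lit 0) (.add (realVar 7)
        (.mul (.get 2 (natVar 8)) (.get 5 (natVar 8))))))
      (.setReal 5 (.lit 0) (realVar 7)))

/-- Subtracts the exact contributions of the low-rank part from the estimates. -/
def subtractLowRank (q : ℕ) : Program :=
  .for 8 (natVar 1) (.seq (.setReal 7 (.lit 0) (.ofNat (.lit 0)))
    (.seq (.for 9 (natVar 0) (.setReal 7 (.lit 0) (.add (realVar 7)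
        (.mul (.get 3 (.add (.mul (natVar 8) (natVar 0)) (natVar 9))) (.get 2 (natVar 9))))))
      (.for 9 (natVar 0) (.setReal 5 (natVar 9) (.sub (.get 5 (natVar 9))
        (.mul (.get 4 (.add (.mul (natVar 9) (natVar 1)) (natVar 8))) (.pow (realVar 7) q)))))))

/-- Computes the estimates of all `⟨A i, u ⊗ ⋯ ⊗ u⟩`, and continues with `post`. -/
def estimateThen (q : ℕ) (post : Program) : Program :=
  .seq (flipCoins (.mul (.mul (natVar 2) (.lit q)) (natVar 3)))
    (.seq (drawSamples q) (.seq (computeMeans q) post))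

/-- The data structure for tensors `A i` of order `q`. -/
def samplingDataStructure (q : ℕ) : DataStructure where
  init := initProgram q
  query := estimateThen q .skip
  queryValue := estimateThen q combineValue
  queryRes := estimateThen q (subtractLowRank q)

/-! ### Correctness of the programs -/

theorem computeNorms_spec (q : ℕ) (s : Store) : Terminates (computeNorms q) s
    (s.nat 0 0 * (s.nat 0 0 ^ q * 4 + 10) + 3) fun s' => ∀ i < s.nat 0 0, s'.real 6 i =
      ∑ r ∈ Finset.range (s.nat 0 0 ^ q), s.real 0 (i * s.nat 0 0 ^ q + r) ^ 2 := by
  set n := s.nat 0 0 with hn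
  refine (Terminates.for (t := n ^ q * 4 + 7) n (fun i s' => ∀ i' < i, s'.real 6 i' =
      ∑ r ∈ Finset.range (n ^ q), s.real 0 (i' * n ^ q + r) ^ 2) rfl
      (fun s' hF => by simp [hF.1 0 rfl, hn]) (by simp) ?_ fun s' _ h => h).mono (by lia)
    fun _ => id
  intro i hi s' hF hc hI
  have h0 : s'.nat 0 0 = n := by rw [hF.1 0 rfl]
  have hA := hF.2 0 rfl
  refine Terminates.of_le (t := 1 + ((n ^ q * (1 + 3) + 3) + 1 + 1) + 1) (by lia)
    (Terminates.seq (Terminates.setReal (Terminates.seq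
      (Terminates.for (n ^ q)
      (fun r s'' => s''.real 7 0 = ∑ r ∈ Finset.range r, s.real 0 (i * n ^ q + r) ^ 2) rfl
      (fun s'' hF' => by simp [hF'.1 0 rfl, h0]) (by simp) ?_ ?_))))
  · intro r hr s'' hF' hc' hI'
    refine Terminates.setReal ?_
    have h0' : s''.nat 0 0 = n := by simp [hF'.1 0 rfl, h0]
    have h8 : s''.nat 8 0 = i := by simp [hF'.1 8 rfl, hc]
    have hA' : s''.real 0 = s.real 0 := by
      rw [hF'.2 0 rfl, Store.setReal_real_of_ne _ _ _ (by decide), hA]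
    simp [h0', h8, hA', hc', hI', Finset.sum_range_succ]
  · intro s'' hF' hI'
    refine Terminates.setReal ?_
    have h8 : s''.nat 8 0 = i := by simp [hF'.1 8 rfl, hc]
    have h6 : s''.real 6 = s'.real 6 := by
      rw [hF'.2 6 rfl, Store.setReal_real_of_ne _ _ _ (by decide)]
    intro i' hi'
    by_cases h : i' = i
    · simp [h8, hI', h]
    · simp [h8, h, h6, hI i' (by omega)]

theorem countDoublings_spec (a : ℕ) (y e : RealExp) (s : Store) (k : ℕ)
    (hlt : ∀ i < k, y.eval s * 2 ^ i < e.eval s) (hle : e.eval s ≤ y.eval s * 2 ^ k)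
    (hy : ∀ s' : Store, s'.real 1 = s.real 1 → y.eval s' = y.eval s)
    (he : ∀ s' : Store, s'.nat 0 = s.nat 0 → e.eval s' = e.eval s) (ha : a ≠ 0) :
    Terminates (countDoublings a y e) s (k * 4 + 5) fun s' => s'.nat a 0 = k := by
  have hw : ∀ c : RealExp, (Program.seq (.setReal 7 (.lit 0) c)
      (.setNat a (.lit 0) (.add (natVar a) (.lit 1)))).writesNat 0 = false := by
    intro c; simpa [Program.writesNat] using ha.symm
  refine Terminates.of_le (t := 1 + (1 + (k * (1 + 1 + 1 + 1) + 1) + 1) + 1) (by lia)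
    (Terminates.seq (Terminates.setNat (Terminates.seq (Terminates.setReal
      (Terminates.loop k (fun i s' => s'.nat a 0 = i ∧ s'.real 7 0 = y.eval s * 2 ^ i)
        ⟨by simp, by simp [hy (s.setNat a 0 0) rfl]⟩ ?_ ?_)))))
  · rintro i hi s' hF ⟨h1, h2⟩
    have h0 : s'.nat 0 = s.nat 0 := by
      rw [hF.1 0 (hw _), Store.setReal_nat, Store.setNat_nat_of_ne _ _ _ ha.symm]
    refine ⟨by simpa [Test.Holds, h2, he s' h0] using hlt i hi, ?_⟩
    refine Terminates.seq (Terminates.setReal (Terminates.setNat ?_))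
    simp [h1, h2, pow_succ]
    ring
  · rintro s' hF ⟨h1, h2⟩
    have h0 : s'.nat 0 = s.nat 0 := by
      rw [hF.1 0 (hw _), Store.setReal_nat, Store.setNat_nat_of_ne _ _ _ ha.symm]
    exact ⟨by simpa [Test.Holds, h2, he s' h0] using hle, h1⟩

theorem countSamples_spec (s : Store) (m : ℕ)
    (hlt : ∀ i < m, i * (s.real 1 0 / 5) ^ 2 < s.nat 4 0)
    (hle : s.nat 4 0 ≤ m * (s.real 1 0 / 5) ^ 2) :
    Terminates countSamples s (m * 2 + 3) fun s' => s'.nat 2 0 = m := by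
  refine Terminates.of_le (t := 1 + (m * (1 + 1) + 1) + 1) (by lia)
    (Terminates.seq (Terminates.setNat (Terminates.loop m (fun i s' => s'.nat 2 0 = i)
      (by simp) ?_ ?_)))
  · intro i hi s' hF h
    refine ⟨by simpa [Test.Holds, h, hF.1 4 rfl, hF.2 1 rfl] using hlt i hi, ?_⟩
    refine Terminates.setNat ?_
    simp [h]
  · intro s' hF h
    exact ⟨by simpa [Test.Holds, h, hF.1 4 rfl, hF.2 1 rfl] using hle, h⟩

/-- The coordinate number `c` is the cell of the number in `[0, 1)` whose binary digits are the
coins of block `c`. -/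
theorem drawSamples_spec (q : ℕ) (s : Store)
    (hbit : ∀ c < s.nat 2 0 * q, ∑ k ∈ Finset.range (s.nat 3 0),
      s.nat 5 (c * s.nat 3 0 + k) * 2 ^ k < 2 ^ s.nat 3 0)
    (hu : ∑ j ∈ Finset.range (s.nat 0 0), s.real 2 j ^ 2 = 1) :
    Terminates (drawSamples q) s
      (s.nat 2 0 * q * (s.nat 3 0 * 4 + s.nat 0 0 * 7 + 20) + 3) fun s' =>
      ∀ c < s.nat 2 0 * q, s'.nat 7 c < s.nat 0 0 ∧ Picks (fun j => s.real 2 j ^ 2)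
        (((∑ k ∈ Finset.range (s.nat 3 0), s.nat 5 (c * s.nat 3 0 + k) * 2 ^ k : ℕ) : ℝ) /
          ((2 ^ s.nat 3 0 : ℕ) : ℝ)) (s'.nat 7 c) := by
  set n := s.nat 0 0 with hn
  set m := s.nat 2 0 with hm
  set B := s.nat 3 0 with hB
  set w : ℕ → ℝ := fun j => s.real 2 j ^ 2 with hw
  set r : ℕ → ℝ := fun c => ((∑ k ∈ Finset.range B, s.nat 5 (c * B + k) * 2 ^ k : ℕ) : ℝ) /
    ((2 ^ B : ℕ) : ℝ) with hr
  have hr0 : ∀ c, 0 ≤ r c := fun c => by positivity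
  have hr1 : ∀ c < m * q, r c < 1 := by
    intro c hc
    rw [hr, div_lt_one (by positivity)]
    exact_mod_cast hbit c hc
  refine (Terminates.for (t := B * 4 + n * 7 + 14) (m * q)
    (fun c s' => ∀ c' < c, s'.nat 7 c' < n ∧ Picks w (r c') (s'.nat 7 c')) rfl
    (fun s' hF => by simp [hF.1 2 rfl, hm]) (by simp) ?_ fun s' _ h => h).mono
    (Nat.add_le_add_right (Nat.mul_le_mul_left _ (by omega)) _) fun _ => id
  intro c hc s1 hF1 h8 hI
  refine Terminates.of_le (t := 1 + ((B * (1 + 3) + 3) + (1 + (1 +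
      (n * (1 + (1 + 1) + 1 + 3) + 3) + 1) + 1) + 1) + 1) (by lia)
    (Terminates.seq (Terminates.setReal (Terminates.seq
      (Terminates.for B
      (fun k s2 => s2.real 8 0 =
        ((∑ k ∈ Finset.range k, s.nat 5 (c * B + k) * 2 ^ k : ℕ) : ℝ) / 2 ^ k) rfl
      (fun s2 hF => by simp [hF.1 3 rfl, hF1.1 3 rfl, hB]) (by simp) ?_ ?_))))
  · intro k hk s2 hF2 h9 h
    refine Terminates.setReal ?_
    have e3 : s2.nat 3 0 = B := by simp [hF2.1 3 rfl, hF1.1 3 rfl, hB]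
    have e5 : s2.nat 5 = s.nat 5 := by rw [hF2.1 5 rfl, Store.setReal_nat, hF1.1 5 rfl]
    have e8 : s2.nat 8 0 = c := by simp [hF2.1 8 rfl, h8]
    simp [e3, e5, e8, h9, h, Finset.sum_range_succ, pow_succ]
    field_simp
  · intro s2 hF2 h2
    have h2' : s2.real 8 0 = r c := by rw [h2, hr]; push_cast; rfl
    have e7 : s2.nat 7 = s1.nat 7 := by rw [hF2.1 7 rfl]; rfl
    have e8 : s2.nat 8 0 = c := by simp [hF2.1 8 rfl, h8]
    refine Terminates.seq (Terminates.setReal (Terminates.seq (Terminates.setNat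
      (Terminates.for n (fun j s3 => s3.real 7 0 = ∑ j ∈ Finset.range j, w j ∧
        (∀ c' < c, s3.nat 7 c' = s1.nat 7 c') ∧ s3.nat 7 c ≤ j ∧
        ∑ i ∈ Finset.range (s3.nat 7 c), w i ≤ r c ∧
        (s3.nat 7 c < j → r c < ∑ i ∈ Finset.range (s3.nat 7 c + 1), w i)) rfl ?_ ?_ ?_ ?_))))
    · intro s3 hF3
      simp [hF3.1 0 rfl, hF2.1 0 rfl, hF1.1 0 rfl, hn]
    · simp only [Store.setNat_real, Store.setReal_real, NatExp.eval, RealExp.eval, e8,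
        Store.setNat_nat, Store.setReal_nat]
      simp [hr0 c, e7]
      intro c' hc' hcc
      omega
    · rintro j hj s3 hF3 h9 ⟨g1, g2, g3, g4, g5⟩
      have f8 : s3.nat 8 0 = c := by simp [hF3.1 8 rfl, e8]
      have f8' : s3.real 8 0 = r c := by
        rw [hF3.2 8 rfl, Store.setNat_real, Store.setReal_real_of_ne _ _ _ (by decide), h2']
      have fu : s3.real 2 = s.real 2 := by
        rw [hF3.2 2 rfl, Store.setNat_real, Store.setReal_real_of_ne _ _ _ (by decide),
          hF2.2 2 rfl, Store.setReal_real_of_ne _ _ _ (by decide), hF1.2 2 rfl]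
      have hsum : ∑ i ∈ Finset.range (j + 1), w i = s3.real 7 0 + s.real 2 j ^ 2 := by
        rw [Finset.sum_range_succ, g1]
      refine Terminates.seq (Terminates.setReal (Terminates.ite (fun hb => Terminates.skip ?_)
        fun hb => Terminates.setNat ?_))
      · simp only [Test.Holds, RealExp.eval, NatExp.eval, Store.setReal_real, f8', h9, fu,
          RealExp.eval_pow] at hb
        simp at hb
        rw [← hsum] at hb
        refine ⟨by simp [h9, fu, hsum], by simpa using g2, by simpa using by omega,
          by simpa using g4, ?_⟩
        simp only [Store.setNat_nat, Store.setReal_nat]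
        simp
        intro hlt
        rcases Nat.lt_or_ge (s3.nat 7 c) j with h | h
        · exact g5 h
        · have : s3.nat 7 c = j := by omega
          rwa [this]
      · simp only [Test.Holds, RealExp.eval, NatExp.eval, Store.setReal_real, f8', h9, fu,
          RealExp.eval_pow] at hb
        simp at hb
        rw [← hsum] at hb
        simp only [NatExp.eval, f8, h9, Store.setReal_nat]
        refine ⟨by simp [h9, fu, hsum], ?_, by simp, by simpa using hb, by simp⟩
        intro c' hc'
        simp [hc'.ne, g2 c' hc']
    · rintro s3 - ⟨g1, g2, g3, g4, g5⟩
      have hlt : s3.nat 7 c < n := by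
        by_contra hge
        have : s3.nat 7 c = n := by omega
        rw [this, hu] at g4
        exact absurd (hr1 c hc) (not_lt.2 g4)
      intro c' hc'
      have heq : (s3.setNat 8 0 (c + 1)).nat 7 c' = s3.nat 7 c' := by simp
      rw [heq]
      by_cases h : c' = c
      · subst h; exact ⟨hlt, g4, g5 hlt⟩
      · rw [g2 c' (by omega)]
        exact hI c' (by omega)

theorem computeMeans_spec (q : ℕ) (s : Store) : Terminates (computeMeans q) s
    (s.nat 0 0 * (s.nat 2 0 * 7 + 10) + 3) fun s' => ∀ i < s.nat 0 0, s'.real 5 i =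
      (∑ τ ∈ Finset.range (s.nat 2 0), truncatedRatio (s.real 6 i) (s.real 1 0 / 5)
        (s.real 0 (i * s.nat 0 0 ^ q +
          ∑ l ∈ Finset.range q, s.nat 7 (τ * q + l) * s.nat 0 0 ^ l))
        (∏ l ∈ Finset.range q, s.real 2 (s.nat 7 (τ * q + l)))) / s.nat 2 0 := by
  set n := s.nat 0 0 with hn
  set m := s.nat 2 0 with hm
  set X : ℕ → ℕ → ℝ := fun i τ => truncatedRatio (s.real 6 i) (s.real 1 0 / 5)
    (s.real 0 (i * n ^ q + ∑ l ∈ Finset.range q, s.nat 7 (τ * q + l) * n ^ l))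
    (∏ l ∈ Finset.range q, s.real 2 (s.nat 7 (τ * q + l))) with hX
  refine (Terminates.for (t := m * 7 + 7) n (fun i s' => ∀ i' < i, s'.real 5 i' =
      (∑ τ ∈ Finset.range m, X i' τ) / m) rfl
      (fun s' hF => by simp [hF.1 0 rfl, hn]) (by simp) ?_ fun s' _ h => h).mono (by lia)
    fun _ => id
  intro i hi s' hF hc hI
  refine Terminates.of_le (t := 1 + ((m * (1 + (1 + 1) + 1 + 3) + 3) + 1 + 1) + 1) (by lia)
    (Terminates.seq (Terminates.setReal (Terminates.seq
      (Terminates.for m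
      (fun τ s'' => s''.real 7 0 = ∑ τ ∈ Finset.range τ, X i τ) rfl
      (fun s'' hF' => by simp [hF'.1 2 rfl, hF.1 2 rfl, hm]) (by simp) ?_ ?_))))
  · intro τ hτ s2 hF2 h9 h
    have e0 : s2.nat 0 0 = n := by simp [hF2.1 0 rfl, hF.1 0 rfl, hn]
    have e7 : s2.nat 7 = s.nat 7 := by rw [hF2.1 7 rfl, Store.setReal_nat, hF.1 7 rfl]
    have e8 : s2.nat 8 0 = i := by simp [hF2.1 8 rfl, hc]
    have f0 : s2.real 0 = s.real 0 := by
      rw [hF2.2 0 rfl, Store.setReal_real_of_ne _ _ _ (by decide), hF.2 0 rfl]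
    have f1 : s2.real 1 = s.real 1 := by
      rw [hF2.2 1 rfl, Store.setReal_real_of_ne _ _ _ (by decide), hF.2 1 rfl]
    have f2 : s2.real 2 = s.real 2 := by
      rw [hF2.2 2 rfl, Store.setReal_real_of_ne _ _ _ (by decide), hF.2 2 rfl]
    have f6 : s2.real 6 = s.real 6 := by
      rw [hF2.2 6 rfl, Store.setReal_real_of_ne _ _ _ (by decide), hF.2 6 rfl]
    refine Terminates.seq (Terminates.setReal (Terminates.ite (fun hb => Terminates.skip ?_)
      fun hb => Terminates.setReal ?_))
    · simp [Test.Holds, e0, e7, e8, f0, f1, f2, f6, h9] at hb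
      simp [h, Finset.sum_range_succ, hX, truncatedRatio, hb]
    · simp [Test.Holds, e0, e7, e8, f0, f1, f2, f6, h9] at hb
      simp [e0, e7, e8, f0, f2, h9, h, Finset.sum_range_succ, hX, truncatedRatio, not_lt.2 hb]
  · intro s2 hF2 h
    refine Terminates.setReal ?_
    have e2 : s2.nat 2 0 = m := by simp [hF2.1 2 rfl, hF.1 2 rfl, hm]
    have e8 : s2.nat 8 0 = i := by simp [hF2.1 8 rfl, hc]
    have f5 : s2.real 5 = s'.real 5 := by
      rw [hF2.2 5 rfl, Store.setReal_real_of_ne _ _ _ (by decide)]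
    intro i' hi'
    by_cases h' : i' = i
    · simp [e8, e2, h, h']
    · simp [e8, h', f5, hI i' (by omega)]

theorem combineValue_spec (s : Store) : Terminates combineValue s (s.nat 0 0 * 4 + 7) fun s' =>
    s'.real 5 0 = ∑ i ∈ Finset.range (s.nat 0 0), s.real 2 i * s.real 5 i := by
  refine Terminates.of_le (t := 1 + ((s.nat 0 0 * (1 + 3) + 3) + 1 + 1) + 1) (by lia)
    (Terminates.seq (Terminates.setReal (Terminates.seq
      (Terminates.for (s.nat 0 0)
      (fun i s' => s'.real 7 0 = ∑ i ∈ Finset.range i, s.real 2 i * s.real 5 i) rfl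
      (fun s' hF => by simp [hF.1 0 rfl]) (by simp) ?_ ?_))))
  · intro i hi s' hF h8 h
    refine Terminates.setReal ?_
    have f2 : s'.real 2 = s.real 2 := by
      rw [hF.2 2 rfl, Store.setReal_real_of_ne _ _ _ (by decide)]
    have f5 : s'.real 5 = s.real 5 := by
      rw [hF.2 5 rfl, Store.setReal_real_of_ne _ _ _ (by decide)]
    simp [f2, f5, h8, h, Finset.sum_range_succ]
  · intro s' hF h
    refine Terminates.setReal ?_
    simp [h]

theorem subtractLowRank_spec (q : ℕ) (s : Store) : Terminates (subtractLowRank q) s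
    (s.nat 1 0 * (s.nat 0 0 * 8 + 12) + 3) fun s' => ∀ i < s.nat 0 0, s'.real 5 i = s.real 5 i -
      ∑ j ∈ Finset.range (s.nat 1 0), s.real 4 (i * s.nat 1 0 + j) *
        (∑ a ∈ Finset.range (s.nat 0 0), s.real 3 (j * s.nat 0 0 + a) * s.real 2 a) ^ q := by
  set n := s.nat 0 0 with hn
  set k := s.nat 1 0 with hk
  set z : ℕ → ℝ := fun j => ∑ a ∈ Finset.range n, s.real 3 (j * n + a) * s.real 2 a with hz
  refine (Terminates.for (t := n * 8 + 9) k (fun j s' => ∀ i < n, s'.real 5 i = s.real 5 i -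
      ∑ j ∈ Finset.range j, s.real 4 (i * k + j) * z j ^ q) rfl
      (fun s' hF => by simp [hF.1 1 rfl, hk]) (by simp) ?_ fun s' _ h => h).mono (by lia)
    fun _ => id
  intro j hj s1 hF1 h8 hI
  refine Terminates.of_le (t := 1 + ((n * (1 + 3) + 3) + (n * (1 + 3) + 3) + 1) + 1) (by lia)
    (Terminates.seq (Terminates.setReal (Terminates.seq
      (Terminates.for n
      (fun a s2 => s2.real 7 0 = ∑ a ∈ Finset.range a, s.real 3 (j * n + a) * s.real 2 a) rfl
      (fun s2 hF => by simp [hF.1 0 rfl, hF1.1 0 rfl, hn]) (by simp) ?_ ?_))))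
  · intro a ha s2 hF2 h9 h
    refine Terminates.setReal ?_
    have e0 : s2.nat 0 0 = n := by simp [hF2.1 0 rfl, hF1.1 0 rfl, hn]
    have e8 : s2.nat 8 0 = j := by simp [hF2.1 8 rfl, h8]
    have f2 : s2.real 2 = s.real 2 := by
      rw [hF2.2 2 rfl, Store.setReal_real_of_ne _ _ _ (by decide), hF1.2 2 rfl]
    have f3 : s2.real 3 = s.real 3 := by
      rw [hF2.2 3 rfl, Store.setReal_real_of_ne _ _ _ (by decide), hF1.2 3 rfl]
    simp [e0, e8, f2, f3, h9, h, Finset.sum_range_succ]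
  · intro s2 hF2 h
    have f5 : s2.real 5 = s1.real 5 := by
      rw [hF2.2 5 rfl, Store.setReal_real_of_ne _ _ _ (by decide)]
    refine Terminates.for n (fun i s3 => ∀ i' < n, s3.real 5 i' = if i' < i then s.real 5 i' -
      ∑ j ∈ Finset.range (j + 1), s.real 4 (i' * k + j) * z j ^ q else s1.real 5 i') rfl
      (fun s3 hF => by simp [hF.1 0 rfl, hF2.1 0 rfl, hF1.1 0 rfl, hn]) (by simp [f5]) ?_ ?_
    · intro i hi s3 hF3 h9 g
      refine Terminates.setReal ?_
      have e1 : s3.nat 1 0 = k := by simp [hF3.1 1 rfl, hF2.1 1 rfl, hF1.1 1 rfl, hk]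
      have e8 : s3.nat 8 0 = j := by simp [hF3.1 8 rfl, hF2.1 8 rfl, h8]
      have f4 : s3.real 4 = s.real 4 := by
        rw [hF3.2 4 rfl, hF2.2 4 rfl, Store.setReal_real_of_ne _ _ _ (by decide), hF1.2 4 rfl]
      have f7 : s3.real 7 0 = z j := by rw [hF3.2 7 rfl, h]
      intro i' hi'
      by_cases hii : i' = i
      · subst hii
        simp [h9, e1, e8, f4, f7, g i' hi', hI i' hi', Finset.sum_range_succ]
        ring
      · have : i' < i + 1 ↔ i' < i := by omega
        simp [h9, hii, g i' hi', this]
    · intro s3 _ g i hi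
      simp [g i hi, hi]

/-! ### Sizes and running times -/

/-- The sizes computed by the initialization: `K` is about `log (n / δ)`, `m` is the number of
samples, and `B` is the number of coins per sampled coordinate. All are least possible. -/
structure Sizes (n q : ℕ) (ε δ : ℝ) (K m B : ℕ) : Prop where
  lt_of_lt_K : ∀ i < K, δ * 2 ^ i < 2 * n
  le_K : 2 * n ≤ δ * 2 ^ K
  lt_of_lt_m : ∀ i < m, i * (ε / 5) ^ 2 < K
  le_m : K ≤ m * (ε / 5) ^ 2
  lt_of_lt_B : ∀ i < B, (ε / 5) ^ 2 * 2 ^ i < q * n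
  le_B : q * n ≤ (ε / 5) ^ 2 * 2 ^ B

theorem exists_least_doubling {y : ℝ} (hy : 0 < y) (x : ℝ) :
    ∃ k : ℕ, (∀ i < k, y * 2 ^ i < x) ∧ x ≤ y * 2 ^ k := by
  classical
  have hex : ∃ k : ℕ, x ≤ y * 2 ^ k := by
    obtain ⟨k, hk⟩ := pow_unbounded_of_one_lt (x / y) one_lt_two
    exact ⟨k, by rw [div_lt_iff₀ hy] at hk; linarith⟩
  exact ⟨Nat.find hex, fun i hi => not_le.1 (Nat.find_min hex hi), Nat.find_spec hex⟩

theorem exists_sizes (n q : ℕ) {ε δ : ℝ} (hε : 0 < ε) (hδ : 0 < δ) :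
    ∃ K m B : ℕ, Sizes n q ε δ K m B := by
  classical
  have he : 0 < (ε / 5) ^ 2 := by positivity
  obtain ⟨K, hK, hK'⟩ := exists_least_doubling hδ (2 * n)
  obtain ⟨B, hB, hB'⟩ := exists_least_doubling he (q * n)
  have hex : ∃ m : ℕ, (K : ℝ) ≤ m * (ε / 5) ^ 2 := by
    obtain ⟨m, hm⟩ := exists_nat_ge (K / (ε / 5) ^ 2)
    exact ⟨m, (div_le_iff₀ he).1 hm⟩
  exact ⟨K, Nat.find hex, B, hK, hK', fun i hi => not_le.1 (Nat.find_min hex hi),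
    Nat.find_spec hex, hB, hB'⟩

namespace Sizes

variable {n q : ℕ} {ε δ : ℝ} {K m B : ℕ}

theorem K_pos (h : Sizes n q ε δ K m B) (hn : 1 ≤ n) (hδ : δ ≤ 1 / 2) : 0 < K := by
  rcases Nat.eq_zero_or_pos K with rfl | hK
  · have h1 := h.le_K
    have h2 : (1 : ℝ) ≤ n := by exact_mod_cast hn
    simp only [pow_zero] at h1
    linarith
  · exact hK

theorem m_pos (h : Sizes n q ε δ K m B) (hn : 1 ≤ n) (hδ : δ ≤ 1 / 2) : 0 < m := by
  rcases Nat.eq_zero_or_pos m with rfl | hm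
  · have h1 := h.le_m
    have h2 : (0 : ℝ) < K := by exact_mod_cast h.K_pos hn hδ
    simp only [Nat.cast_zero, zero_mul] at h1
    linarith
  · exact hm

/-- The union bound over the `n` tensors succeeds with `m` samples. -/
theorem failure_le (h : Sizes n q ε δ K m B) : n * (2 * Real.exp (-(m * (ε / 5) ^ 2))) ≤ δ := by
  have h1 : (2 : ℝ) ^ K ≤ Real.exp (m * (ε / 5) ^ 2) := by
    calc (2 : ℝ) ^ K ≤ Real.exp 1 ^ K :=
          pow_le_pow_left₀ (by norm_num) (by linarith [Real.add_one_le_exp (1 : ℝ)]) K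
      _ = Real.exp K := by rw [← Real.exp_nat_mul, mul_one]
      _ ≤ _ := Real.exp_le_exp.2 h.le_m
  have hpos : (0 : ℝ) < 2 ^ K := by positivity
  have hδ : 0 ≤ δ := by
    have := h.le_K
    have hn : (0 : ℝ) ≤ 2 * n := by positivity
    exact nonneg_of_mul_nonneg_left (hn.trans this) hpos
  rw [Real.exp_neg, ← div_eq_mul_inv, ← mul_div_assoc, div_le_iff₀ (Real.exp_pos _)]
  calc n * 2 = 2 * (n : ℝ) := mul_comm _ _
    _ ≤ δ * 2 ^ K := h.le_K
    _ ≤ _ := mul_le_mul_of_nonneg_left h1 hδ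

/-- The bound on the number of samples and coins that all running times reduce to. The size `g`
will be a power of `n`. -/
theorem mul_le (h : Sizes n q ε δ K m B) (hn : 1 ≤ n) (hq : 1 ≤ q) (hε : 0 < ε) (hε1 : ε < 1)
    (hδ : 0 < δ) (hδ2 : δ ≤ 1 / 2) {g : ℝ} (hg : n ≤ g) :
    (m : ℝ) * (B + 1) ≤ 504 * (8 + 4 * Real.log (25 * q)) *
      (ε⁻¹ ^ 2 * Real.log (1 / δ) * Real.log (ε⁻¹ ^ 2 * g * Real.log (1 / δ) + 2) ^ 2) := by
  set L := Real.log (1 / δ) with hL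
  set F := ε⁻¹ ^ 2 * g * L + 2 with hF
  set Λ := Real.log F with hΛ
  have hn' : (1 : ℝ) ≤ n := by exact_mod_cast hn
  have hq' : (1 : ℝ) ≤ q := by exact_mod_cast hq
  have hlog2 : (1 / 2 : ℝ) ≤ Real.log 2 := by linarith [Real.log_two_gt_d9]
  have hLd : L = -Real.log δ := by rw [hL, one_div, Real.log_inv]
  have hL2 : 1 / 2 ≤ L := by
    refine hlog2.trans (Real.log_le_log (by norm_num) ?_)
    rw [le_div_iff₀ hδ]; linarith
  have hE : 1 ≤ ε⁻¹ ^ 2 := one_le_pow₀ (one_le_inv₀ hε |>.2 hε1.le)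
  have hEε : ε⁻¹ ^ 2 * ε ^ 2 = 1 := by rw [← mul_pow, inv_mul_cancel₀ hε.ne', one_pow]
  set E := ε⁻¹ ^ 2 with hEdef
  have hEn : E * n ≤ 2 * F := by
    have h1 : E * n ≤ E * g := mul_le_mul_of_nonneg_left hg (by linarith)
    have h2 : 0 ≤ E * g := le_trans (by positivity) h1
    nlinarith
  have hnF : (n : ℝ) ≤ 2 * F := le_trans (by nlinarith) hEn
  have hF2 : 2 ≤ F := by
    have : 0 ≤ E * g * L := mul_nonneg (mul_nonneg (by linarith) (by linarith)) (by linarith)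
    linarith
  have hΛ2 : 1 / 2 ≤ Λ := hlog2.trans (Real.log_le_log (by norm_num) hF2)
  have hlogn : Real.log (2 * n) ≤ 3 * Λ := by
    have h1 : (2 * n : ℝ) ≤ F ^ 3 := by nlinarith [mul_nonneg (sub_nonneg.2 hF2) (sub_nonneg.2 hF2)]
    refine (Real.log_le_log (by linarith) h1).trans (le_of_eq ?_)
    rw [Real.log_pow]; norm_num [hΛ]
  have hlogEn : Real.log (E * n) ≤ 2 * Λ := by
    have h1 : E * n ≤ F ^ 2 := by nlinarith
    refine (Real.log_le_log (by positivity) h1).trans (le_of_eq ?_)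
    rw [Real.log_pow]; norm_num [hΛ]
  have hΛL1 : Λ ≤ 2 * (Λ * L) := by nlinarith
  have hΛL2 : L ≤ 2 * (Λ * L) := by nlinarith
  have hΛL : 1 / 4 ≤ Λ * L := by linarith
  have hEΛL : Λ * L ≤ E * (Λ * L) := le_mul_of_one_le_left (by linarith) hE
  have hK : (K : ℝ) ≤ 20 * (Λ * L) := by
    obtain ⟨k, rfl⟩ := Nat.exists_eq_succ_of_ne_zero (h.K_pos hn hδ2).ne'
    have h1 := h.lt_of_lt_K k (Nat.lt_succ_self k)
    have h2 := Real.log_lt_log (by positivity) h1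
    rw [Real.log_mul hδ.ne' (by positivity), Real.log_pow] at h2
    have h3 : (k : ℝ) * (1 / 2) ≤ k * Real.log 2 :=
      mul_le_mul_of_nonneg_left hlog2 (Nat.cast_nonneg k)
    have hk : (k : ℝ) ≤ 6 * Λ + 2 * L := by linarith
    rw [Nat.cast_succ]
    linarith
  have hm : (m : ℝ) ≤ 504 * (E * (Λ * L)) := by
    obtain ⟨k, rfl⟩ := Nat.exists_eq_succ_of_ne_zero (h.m_pos hn hδ2).ne'
    have h1 := h.lt_of_lt_m k (Nat.lt_succ_self k)
    have h2 : (k : ℝ) * (ε / 5) ^ 2 * (25 * E) = (k : ℝ) := by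
      rw [div_pow]
      calc (k : ℝ) * (ε ^ 2 / 5 ^ 2) * (25 * E) = (k : ℝ) * (E * ε ^ 2) := by ring
        _ = (k : ℝ) := by rw [hEε, mul_one]
    have h3 : (k : ℝ) ≤ 500 * (E * (Λ * L)) := by
      rw [← h2]
      calc (k : ℝ) * (ε / 5) ^ 2 * (25 * E) ≤ 20 * (Λ * L) * (25 * E) :=
            mul_le_mul_of_nonneg_right (h1.le.trans hK) (by linarith)
        _ = _ := by ring
    rw [Nat.cast_succ]
    linarith
  have hlogq : 0 ≤ Real.log (25 * q) := Real.log_nonneg (by linarith)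
  have hlogqΛ : Real.log (25 * q) ≤ 2 * (Real.log (25 * q) * Λ) := by nlinarith
  have hB : (B : ℝ) + 1 ≤ (8 + 4 * Real.log (25 * q)) * Λ := by
    rcases B with _ | k
    · rw [Nat.cast_zero]
      linarith
    have h1 := h.lt_of_lt_B k (Nat.lt_succ_self k)
    have h2 : (2 : ℝ) ^ k < 25 * q * (E * n) := by
      have h3 : (ε / 5) ^ 2 * 2 ^ k * (25 * E) = 2 ^ k := by
        rw [div_pow]
        calc ε ^ 2 / 5 ^ 2 * 2 ^ k * (25 * E) = 2 ^ k * (E * ε ^ 2) := by ring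
          _ = 2 ^ k := by rw [hEε, mul_one]
      rw [← h3]
      calc (ε / 5) ^ 2 * 2 ^ k * (25 * E) < q * n * (25 * E) :=
            mul_lt_mul_of_pos_right h1 (by linarith)
        _ = _ := by ring
    have h4 := Real.log_lt_log (by positivity) h2
    rw [Real.log_mul (by positivity) (by positivity), Real.log_pow] at h4
    have h5 : (k : ℝ) * (1 / 2) ≤ k * Real.log 2 :=
      mul_le_mul_of_nonneg_left hlog2 (Nat.cast_nonneg k)
    rw [Nat.cast_succ]
    linarith
  calc (m : ℝ) * (B + 1) ≤ 504 * (E * (Λ * L)) * ((8 + 4 * Real.log (25 * q)) * Λ) :=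
        mul_le_mul hm hB (by positivity) (by linarith)
    _ = _ := by ring

end Sizes

/-! ### Memory layout and initialization -/

theorem vecArray_apply {m : ℕ} (v : Fin m → ℝ) (i : Fin m) : vecArray v i = v i := by
  simp [vecArray]

theorem matArray_apply {m k : ℕ} (M : Fin m → Fin k → ℝ) (i : Fin m) (j : Fin k) :
    matArray M (i * k + j) = M i j := by
  have h : (i * k + j : ℕ) = (finProdFinEquiv (i, j) : Fin (m * k)) := by
    simp [finProdFinEquiv, mul_comm, add_comm]
  have h' := finProdFinEquiv.symm_apply_apply (i, j)
  rw [matArray, h, vecArray_apply]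
  rw [finProdFinEquiv_symm_apply] at h'
  exact congrArg (fun x : Fin m × Fin k => M x.1 x.2) h'

/-- The part of the memory that persists between requests: the input and the numbers computed by
the initialization. -/
structure Ready {n q : ℕ} (A : Fin n → Tensor n q) (ε : ℝ) (m B : ℕ) (s : Store) : Prop where
  n_eq : s.nat 0 0 = n
  m_eq : s.nat 2 0 = m
  B_eq : s.nat 3 0 = B
  precision_eq : s.real 1 0 = ε
  entry_eq : ∀ (i : Fin n) (J : Fin q → Fin n),
    s.real 0 (i * n ^ q + ∑ l, (J l : ℕ) * n ^ (l : ℕ)) = A i J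
  norm_eq : ∀ i : Fin n, s.real 6 i = ∑ J, A i J ^ 2

theorem Ready.congr {n q : ℕ} {A : Fin n → Tensor n q} {ε : ℝ} {m B : ℕ} {s s' : Store}
    (h : Ready A ε m B s) (hn : ∀ a, a = 0 ∨ a = 2 ∨ a = 3 → s'.nat a = s.nat a)
    (hr : ∀ a, a = 0 ∨ a = 1 ∨ a = 6 → s'.real a = s.real a) : Ready A ε m B s' where
  n_eq := by rw [hn 0 (by simp), h.n_eq]
  m_eq := by rw [hn 2 (by simp), h.m_eq]
  B_eq := by rw [hn 3 (by simp), h.B_eq]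
  precision_eq := by rw [hr 1 (by simp), h.precision_eq]
  entry_eq i J := by rw [hr 0 (by simp), h.entry_eq]
  norm_eq i := by rw [hr 6 (by simp), h.norm_eq]

theorem Ready.load {n q : ℕ} {A : Fin n → Tensor n q} {ε : ℝ} {m B : ℕ} {s : Store}
    (h : Ready A ε m B s) (r : Request n) : Ready A ε m B (r.load s) := by
  cases r <;> refine h.congr ?_ ?_ <;> rintro a (rfl | rfl | rfl) <;>
    simp [Request.load, Store.setRealArray, Store.setNat, Store.setNatArray]

theorem initProgram_spec {n q : ℕ} {ε δ : ℝ} {K m B : ℕ} (hS : Sizes n q ε δ K m B)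
    (A : Fin n → Tensor n q) : Terminates (initProgram q) (initStore ε δ A)
      (n * (n ^ q * 4 + 10) + K * 4 + m * 2 + B * 4 + 19) (Ready A ε m B) := by
  set s := initStore ε δ A with hs
  have h0 : s.nat 0 0 = n := by simp [hs, initStore, Store.setRealArray]
  have hA : s.real 0 = matArray fun i r => A i (finFunctionFinEquiv.symm r) := by
    simp [hs, initStore, Store.setRealArray]
  have hε : s.real 1 0 = ε := by simp [hs, initStore, Store.setRealArray, vecArray]
  have hδ : s.real 1 1 = δ := by simp [hs, initStore, Store.setRealArray, vecArray]
  have hnorm := computeNorms_spec q s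
  rw [h0] at hnorm
  refine Terminates.of_le (t := (n * (n ^ q * 4 + 10) + 3) + ((K * 4 + 5) + ((m * 2 + 3) +
    (B * 4 + 5) + 1) + 1) + 1) (by omega) (Terminates.seq (hnorm.frame.mono le_rfl ?_))
  rintro s1 ⟨h1, hF1⟩
  have e1 : s1.real 1 = s.real 1 := hF1.2 1 rfl
  have n1 : s1.nat 0 0 = n := by rw [hF1.1 0 rfl, h0]
  refine Terminates.seq ((countDoublings_spec 4 _ _ s1 K ?_ ?_ ?_ ?_ (by decide)).frame.mono
    le_rfl ?_)
  · simpa [e1, hδ, n1] using hS.lt_of_lt_K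
  · simpa [e1, hδ, n1] using hS.le_K
  · intro s' h; simp [h]
  · intro s' h; simp [h]
  rintro s2 ⟨h2, hF2⟩
  have e2 : s2.real 1 = s.real 1 := by rw [hF2.2 1 rfl, e1]
  have n2 : s2.nat 0 0 = n := by rw [hF2.1 0 rfl, n1]
  refine Terminates.seq ((countSamples_spec s2 m ?_ ?_).frame.mono le_rfl ?_)
  · simpa [e2, hε, h2] using hS.lt_of_lt_m
  · simpa [e2, hε, h2] using hS.le_m
  rintro s3 ⟨h3, hF3⟩
  have e3 : s3.real 1 = s.real 1 := by rw [hF3.2 1 rfl, e2]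
  have n3 : s3.nat 0 0 = n := by rw [hF3.1 0 rfl, n2]
  refine (countDoublings_spec 3 _ _ s3 B ?_ ?_ ?_ ?_ (by decide)).frame.mono le_rfl ?_
  · simpa [e3, hε, n3] using hS.lt_of_lt_B
  · simpa [e3, hε, n3] using hS.le_B
  · intro s' h; simp [h]
  · intro s' h; simp [h]
  rintro s4 ⟨h4, hF4⟩
  refine ⟨?_, ?_, h4, ?_, fun i J => ?_, fun i => ?_⟩
  · rw [hF4.1 0 rfl, n3]
  · rw [hF4.1 2 rfl, h3]
  · rw [hF4.2 1 rfl, e3, hε]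
  · rw [hF4.2 0 rfl, hF3.2 0 rfl, hF2.2 0 rfl, hF1.2 0 rfl, hA, ← finFunctionFinEquiv_apply,
      matArray_apply, Equiv.symm_apply_apply]
  · rw [hF4.2 6 rfl, hF3.2 6 rfl, hF2.2 6 rfl, h1 i i.2, hA,
      ← Fin.sum_univ_eq_sum_range (fun r => matArray (fun i r => A i (finFunctionFinEquiv.symm r))
        (i * n ^ q + r) ^ 2)]
    simp only [matArray_apply]
    exact finFunctionFinEquiv.symm.sum_comp fun J => A i J ^ 2

/-! ### The estimates of a request -/

/-- The coins, grouped into blocks of `B` that encode numbers below `2 ^ B`. -/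
theorem exists_coin_equiv (m q B : ℕ) :
    ∃ Φ : (Fin (m * q * B) → Bool) ≃ (Fin m → Fin q → Fin (2 ^ B)), ∀ b τ l,
      (Φ b τ l : ℕ) = ∑ k : Fin B,
        (if b (finProdFinEquiv (finProdFinEquiv (τ, l), k)) then 1 else 0) * 2 ^ (k : ℕ) := by
  refine ⟨(Equiv.arrowCongr finProdFinEquiv.symm (Equiv.refl Bool)).trans
    ((Equiv.curry _ _ _).trans ((Equiv.arrowCongr finProdFinEquiv.symm
      ((Equiv.arrowCongr (Equiv.refl _) finTwoEquiv.symm).trans finFunctionFinEquiv)).trans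
      (Equiv.curry _ _ _))), fun b τ l => ?_⟩
  simp only [Equiv.trans_apply, Equiv.curry_apply, Function.curry_apply, Equiv.arrowCongr_apply,
    Equiv.symm_symm, Function.comp_apply, finFunctionFinEquiv_apply, Equiv.refl_symm,
    Equiv.coe_refl, id_eq]
  refine Finset.sum_congr rfl fun k _ => ?_
  congr 1
  cases b (finProdFinEquiv (finProdFinEquiv (τ, l), k)) <;> rfl

/-- The estimates are accurate for all but a fraction `δ` of the coins; `Q v` is what the
continuation achieves when it starts from the estimates `v`. -/
theorem run_estimateThen {n q : ℕ} {A : Fin n → Tensor n q} {ε δ : ℝ} {K m B : ℕ} (hn : 1 ≤ n)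
    (hε : 0 < ε) (hδ2 : δ ≤ 1 / 2) (hS : Sizes n q ε δ K m B) {s : Store}
    (hs : Ready A ε m B s) (u : UnitVec n) (hu : s.real 2 = vecArray u.1) {post : Program}
    {tp : ℕ} {Q : (ℕ → ℝ) → Store → Prop}
    (hpost : ∀ s' : Store, (∀ a, a < 2 → s'.nat a = s.nat a) →
      (∀ a, 2 ≤ a → a < 5 → s'.real a = s.real a) → Terminates post s' tp (Q (s'.real 5)))
    (hwn : ∀ a, a = 0 ∨ a = 2 ∨ a = 3 → post.writesNat a = false)
    (hwr : ∀ a, a = 0 ∨ a = 1 ∨ a = 6 → post.writesReal a = false) :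
    ∃ (M : ℕ) (out : (Fin M → Bool) → Store), (∀ b, Ready A ε m B (out b)) ∧
      (∀ T, 4 * (m * q * B) + m * q * (B * 4 + n * 7 + 20) + n * (m * 7 + 10) + tp + 12 ≤ T →
        run T ([estimateThen q post], s) =
          (PMF.uniformOfFintype (Fin M → Bool)).map fun b => ([], out b)) ∧
      ({b | ¬ ∃ v : ℕ → ℝ, (∀ i : Fin n, |v i - (A i).inner (Tensor.power u.1 q)| ≤
          ε * (A i).frobenius) ∧ Q v (out b)}.ncard : ℝ) ≤ δ * 2 ^ M := by
  obtain ⟨Φ, hΦ⟩ := exists_coin_equiv m q B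
  let w : ℕ → ℝ := fun j => s.real 2 j ^ 2
  have hw : ∀ j, 0 ≤ w j := fun j => sq_nonneg _
  have hwu : ∀ j : Fin n, w j = u.1 j ^ 2 := by
    intro j
    show s.real 2 j ^ 2 = _
    rw [hu, vecArray_apply]
  have hsum : ∑ j ∈ Finset.range n, w j = 1 := by
    rw [← Fin.sum_univ_eq_sum_range, ← u.2]
    exact Finset.sum_congr rfl fun j _ => hwu j
  have hN : 0 < 2 ^ B := by positivity
  have hex : ∀ R : Fin (2 ^ B), ∃ J : Fin n, Picks w ((R : ℝ) / (2 ^ B : ℕ)) J := by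
    intro R
    obtain ⟨J, hJ, h⟩ := exists_picks (w := w) (n := n) (r := (R : ℝ) / (2 ^ B : ℕ))
      (by positivity) (by
        rw [hsum, div_lt_one (by positivity)]
        exact_mod_cast R.2)
    exact ⟨⟨J, hJ⟩, h⟩
  choose pick hpick using hex
  let est : (Fin m → Fin q → Fin (2 ^ B)) → Fin n → ℝ := fun R i =>
    (∑ τ, truncatedRatio (∑ J, A i J ^ 2) (ε / 5) (A i fun l => pick (R τ l))
      (∏ l, u.1 (pick (R τ l)))) / m
  obtain ⟨out, hout, hrun⟩ := run_flipCoins_seq (M := m * q * B) (s := s)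
    (e := .mul (.mul (natVar 2) (.lit q)) (natVar 3))
    (P := .seq (drawSamples q) (.seq (computeMeans q) post))
    (t := (m * q * (B * 4 + n * 7 + 20) + 3) + ((n * (m * 7 + 10) + 3) + tp + 1) + 1)
    (Q := fun b s' => Ready A ε m B s' ∧ ∃ v : ℕ → ℝ, (∀ i : Fin n, v i = est (Φ b) i) ∧ Q v s')
    (fun s' h => by
      simp [h 2 (by decide) (by decide), h 3 (by decide) (by decide), hs.m_eq, hs.B_eq])
    (fun b s' hb hnat hreal => by
      have hs' : Ready A ε m B s' := hs.congr
        (by rintro a (rfl | rfl | rfl) <;> exact hnat _ (by decide) (by decide))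
        (fun a _ => by rw [hreal])
      have hR : ∀ (τ : Fin m) (l : Fin q), ∑ k ∈ Finset.range B,
          s'.nat 5 ((τ * q + l) * B + k) * 2 ^ k = Φ b τ l := by
        intro τ l
        rw [hΦ, ← Fin.sum_univ_eq_sum_range (fun k => s'.nat 5 ((τ * q + l) * B + k) * 2 ^ k)]
        refine Finset.sum_congr rfl fun k _ => ?_
        rw [← hb]
        congr 2
        simp only [finProdFinEquiv_apply_val]
        ring
      have hdraw := drawSamples_spec q s'
      rw [hs'.n_eq, hs'.m_eq, hs'.B_eq] at hdraw
      refine Terminates.seq ((hdraw ?_ ?_).frame.mono le_rfl ?_)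
      · intro c hc
        have h := finProdFinEquiv.apply_symm_apply (⟨c, hc⟩ : Fin (m * q))
        generalize finProdFinEquiv.symm (⟨c, hc⟩ : Fin (m * q)) = x at h
        have h' := congrArg Fin.val h
        simp only [finProdFinEquiv_apply_val] at h'
        rw [← h', show (x.2 + q * x.1 : ℕ) = x.1 * q + x.2 by ring, hR]
        exact Fin.is_lt _
      · rw [hreal]; exact hsum
      rintro s1 ⟨h1, hF1⟩
      have hs1 : Ready A ε m B s1 := hs'.congr
        (by rintro a (rfl | rfl | rfl) <;> exact hF1.1 _ rfl)
        (by rintro a (rfl | rfl | rfl) <;> exact hF1.2 _ rfl)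
      have hpick1 : ∀ (τ : Fin m) (l : Fin q), s1.nat 7 (τ * q + l) = pick (Φ b τ l) := by
        intro τ l
        have hlt : (τ * q + l : ℕ) < m * q := by
          have := (finProdFinEquiv (τ, l)).2
          rw [finProdFinEquiv_apply_val] at this
          calc (τ * q + l : ℕ) = l + q * τ := by ring
            _ < m * q := this
        have h := (h1 _ hlt).2
        rw [hR, hreal] at h
        exact h.unique hw (hpick (Φ b τ l))
      have hu1 : s1.real 2 = vecArray u.1 := by rw [hF1.2 2 rfl, hreal, hu]
      have hmeans := computeMeans_spec q s1
      rw [hs1.n_eq, hs1.m_eq] at hmeans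
      refine Terminates.seq (hmeans.frame.mono le_rfl ?_)
      rintro s2 ⟨h2, hF2⟩
      refine ((hpost s2 ?_ ?_).frame).mono le_rfl ?_
      · intro a ha
        interval_cases a
        · rw [hF2.1 0 rfl, hF1.1 0 rfl, hnat 0 (by decide) (by decide)]
        · rw [hF2.1 1 rfl, hF1.1 1 rfl, hnat 1 (by decide) (by decide)]
      · intro a ha ha'
        interval_cases a
        · rw [hF2.2 2 rfl, hF1.2 2 rfl, hreal]
        · rw [hF2.2 3 rfl, hF1.2 3 rfl, hreal]
        · rw [hF2.2 4 rfl, hF1.2 4 rfl, hreal]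
      rintro s3 ⟨hQ, hF3⟩
      refine ⟨hs1.congr ?_ ?_, s2.real 5, fun i => ?_, hQ⟩
      · intro a ha
        rw [hF3.1 a (hwn a ha), hF2.1 a (by rcases ha with rfl | rfl | rfl <;> rfl)]
      · intro a ha
        rw [hF3.2 a (hwr a ha), hF2.2 a (by rcases ha with rfl | rfl | rfl <;> rfl)]
      · rw [h2 i i.2, hs1.norm_eq, hs1.precision_eq, Finset.sum_range]
        congr 1
        refine Finset.sum_congr rfl fun τ _ => ?_
        rw [Finset.sum_range, Finset.prod_range]
        simp only [hpick1, hu1, vecArray_apply]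
        rw [hs1.entry_eq i fun l => pick (Φ b τ l)])
  refine ⟨m * q * B, out, fun b => (hout b).1, fun T hT => hrun T (by omega), ?_⟩
  let bad : Fin n → Set (Fin m → Fin q → Fin (2 ^ B)) := fun i =>
    {R | 5 * (ε / 5) * (A i).frobenius < |est R i - (A i).inner (Tensor.power u.1 q)|}
  have hbad : ∀ i, ((bad i).ncard : ℝ) ≤
      2 * Real.exp (-(m * (ε / 5) ^ 2)) * (((2 ^ B : ℕ) : ℝ) ^ q) ^ m := fun i =>
    card_estimate_bad_le (by positivity) u.2 hw hwu hN
      (by push_cast; rw [mul_comm ((2 : ℝ) ^ B)]; exact hS.le_B) hpick (hS.m_pos hn hδ2)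
  have hsub : {b | ¬ ∃ v : ℕ → ℝ, (∀ i : Fin n, |v i - (A i).inner (Tensor.power u.1 q)| ≤
      ε * (A i).frobenius) ∧ Q v (out b)} ⊆ Φ ⁻¹' ⋃ i, bad i := by
    intro b hb
    by_contra hnot
    refine hb ?_
    obtain ⟨v, hv, hQ⟩ := (hout b).2
    refine ⟨v, fun i => ?_, hQ⟩
    have h : Φ b ∉ bad i := fun h => hnot (Set.mem_iUnion.2 ⟨i, h⟩)
    have h' : |est (Φ b) i - _| ≤ 5 * (ε / 5) * (A i).frobenius := le_of_not_gt h
    rw [hv i]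
    calc _ ≤ _ := h'
      _ = _ := by ring
  have hcard : (Φ ⁻¹' ⋃ i, bad i).ncard ≤ ∑ i, (bad i).ncard := by
    rw [Set.ncard_preimage_of_injective_subset_range Φ.injective (by simp)]
    exact Set.ncard_iUnion_le_of_fintype _
  calc _ ≤ ((∑ i, (bad i).ncard : ℕ) : ℝ) :=
        Nat.cast_le.2 ((Set.ncard_le_ncard hsub (Set.toFinite _)).trans hcard)
    _ ≤ ∑ _i : Fin n, 2 * Real.exp (-(m * (ε / 5) ^ 2)) * (((2 ^ B : ℕ) : ℝ) ^ q) ^ m := by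
        push_cast
        exact Finset.sum_le_sum fun i _ => by simpa using hbad i
    _ = n * (2 * Real.exp (-(m * (ε / 5) ^ 2))) * 2 ^ (m * q * B) := by
        rw [Finset.sum_const, Finset.card_univ, Fintype.card_fin, nsmul_eq_mul]
        push_cast
        rw [← pow_mul, ← pow_mul, show B * (q * m) = m * q * B by ring]
        ring
    _ ≤ δ * 2 ^ (m * q * B) := mul_le_mul_of_nonneg_right hS.failure_le (by positivity)

/-! ### Correctness of the answers -/

namespace Tensor

theorem inner_power_power {n q : ℕ} (x u : Fin n → ℝ) :
    (power x q).inner (power u q) = (∑ a, x a * u a) ^ q := by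
  simp only [inner, power, ← Finset.prod_mul_distrib]
  exact (Fintype.sum_pow (fun a => x a * u a) q).symm

theorem inner_sub_sum_smul {n q k : ℕ} (S U : Tensor n q) (c : Fin k → ℝ)
    (T : Fin k → Tensor n q) :
    inner (S - ∑ j, c j • T j) U = S.inner U - ∑ j, c j * (T j).inner U := by
  simp only [inner, Pi.sub_apply, Finset.sum_apply, Pi.smul_apply, smul_eq_mul, sub_mul,
    Finset.sum_sub_distrib, Finset.sum_mul, Finset.mul_sum]
  rw [Finset.sum_comm]
  simp only [mul_assoc]

theorem sum_stack {n q : ℕ} (A : Fin n → Tensor n q) (f : ℝ → (Fin (q + 1) → Fin n) → ℝ) :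
    ∑ j, f ((stack A : Tensor n (q + 1)) j) j =
      ∑ i, ∑ J : Fin q → Fin n, f (A i J) (Fin.cons i J : Fin (q + 1) → Fin n) := by
  rw [← (Fin.consEquiv fun _ => Fin n).sum_comp, Fintype.sum_prod_type]
  refine Finset.sum_congr rfl fun i _ => Finset.sum_congr rfl fun J _ => ?_
  have h : (stack A : Tensor n (q + 1)) (Fin.cons i J : Fin (q + 1) → Fin n) = A i J := by
    rw [stack, dif_pos (Nat.succ_pos q)]
    rfl
  exact congrArg (fun a => f a (Fin.cons i J : Fin (q + 1) → Fin n)) h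

theorem inner_stack {n q : ℕ} (A : Fin n → Tensor n q) (u : Fin n → ℝ) :
    (stack A : Tensor n (q + 1)).inner (power u (q + 1)) =
      ∑ i, u i * (A i).inner (power u q) := by
  rw [inner, sum_stack A fun a j => a * power u (q + 1) j]
  refine Finset.sum_congr rfl fun i _ => ?_
  rw [inner, Finset.mul_sum]
  refine Finset.sum_congr rfl fun J _ => ?_
  simp only [power, Fin.prod_univ_succ, Fin.cons_zero, Fin.cons_succ]
  ring

theorem frobenius_stack {n q : ℕ} (A : Fin n → Tensor n q) :
    (stack A : Tensor n (q + 1)).frobenius = √(∑ i, (A i).frobenius ^ 2) := by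
  rw [frobenius, sum_stack A fun a _ => a ^ 2]
  congr 1
  refine Finset.sum_congr rfl fun i _ => ?_
  rw [frobenius, Real.sq_sqrt (Finset.sum_nonneg fun _ _ => sq_nonneg _)]

end Tensor

theorem Approx.of_le {ε D F t v : ℝ} (hε : 0 ≤ ε) (hF : F ≤ D) (h : |v - t| ≤ ε * F) :
    Approx ε D t v := by
  have h1 : 0 ≤ ε * |t| := by positivity
  have h2 : ε * F ≤ ε * D := mul_le_mul_of_nonneg_left hF hε
  unfold Approx
  linarith

/-- The number of steps of a request after the estimates have been computed. -/
def Request.postTime {n : ℕ} : Request n → ℕ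
  | query _ => 1
  | queryValue _ => n * 4 + 7
  | queryRes k _ _ _ => k * (n * 8 + 12) + 3

/-- A single request, on a memory prepared by the initialization. -/
theorem run_request {n q : ℕ} {A : Fin n → Tensor n q} {ε δ : ℝ} {K m B : ℕ} (hn : 1 ≤ n)
    (hε : 0 < ε) (hδ2 : δ ≤ 1 / 2) (hS : Sizes n q ε δ K m B) {D : Fin n → ℝ} {Dtot : ℝ}
    (hD : ∀ i, (A i).frobenius ≤ D i) (hDtot : (Tensor.stack A : Tensor n (q + 1)).frobenius ≤ Dtot)
    {s : Store} (hs : Ready A ε m B s) (r : Request n) :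
    ∃ (M : ℕ) (out : (Fin M → Bool) → Store), (∀ b, Ready A ε m B (out b)) ∧
      (∀ T, 4 * (m * q * B) + m * q * (B * 4 + n * 7 + 20) + n * (m * 7 + 10) + r.postTime + 12
          ≤ T → run T ([r.program (samplingDataStructure q)], r.load s) =
          (PMF.uniformOfFintype (Fin M → Bool)).map fun b => ([], out b)) ∧
      ({b | ¬ Request.Correct (p := q + 1) A D Dtot ε r (r.read (out b))}.ncard : ℝ)
        ≤ δ * 2 ^ M := by
  have hmono : ∀ {M : ℕ} {S T : Set (Fin M → Bool)}, S ⊆ T → (T.ncard : ℝ) ≤ δ * 2 ^ M →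
      (S.ncard : ℝ) ≤ δ * 2 ^ M := fun h h' =>
    (Nat.cast_le.2 (Set.ncard_le_ncard h (Set.toFinite _))).trans h'
  cases r with
  | query u =>
    obtain ⟨M, out, h1, h2, h3⟩ := run_estimateThen hn hε hδ2 hS (hs.load (.query u)) u
      (by simp [Request.load, Store.setRealArray]) (post := .skip) (tp := 1)
      (Q := fun v s' => s'.real 5 = v) (fun s' _ _ => Terminates.skip rfl)
      (fun _ _ => rfl) fun _ _ => rfl
    refine ⟨M, out, h1, h2, hmono (fun b hb => ?_) h3⟩
    rintro ⟨v, hv, hQ⟩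
    refine hb fun i => ?_
    refine Approx.of_le hε.le (hD i) ?_
    simp only [Request.read, hQ]
    exact hv i
  | queryValue u =>
    have hu : (Request.load s (.queryValue u)).real 2 = vecArray u.1 := by
      simp [Request.load, Store.setRealArray]
    have hl := hs.load (.queryValue u)
    obtain ⟨M, out, h1, h2, h3⟩ := run_estimateThen hn hε hδ2 hS hl u hu
      (post := combineValue) (tp := n * 4 + 7)
      (Q := fun v s' => s'.real 5 0 = ∑ i : Fin n, u.1 i * v i)
      (fun s' hnat hreal => by
        have h := combineValue_spec s'
        rw [hnat 0 (by decide), hl.n_eq, hreal 2 (by decide) (by decide), hu,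
          Finset.sum_range] at h
        simpa only [vecArray_apply] using h)
      (by rintro a (rfl | rfl | rfl) <;> rfl) (by rintro a (rfl | rfl | rfl) <;> rfl)
    refine ⟨M, out, h1, h2, hmono (fun b hb => ?_) h3⟩
    rintro ⟨v, hv, hQ⟩
    refine hb (Approx.of_le hε.le hDtot ?_)
    simp only [Request.read, hQ]
    rw [Tensor.frobenius_stack, Tensor.inner_stack,
      ← Finset.sum_sub_distrib]
    calc |∑ i, (u.1 i * v i - u.1 i * (A i).inner (Tensor.power u.1 q))|
        ≤ ∑ i, |u.1 i * v i - u.1 i * (A i).inner (Tensor.power u.1 q)| :=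
          Finset.abs_sum_le_sum_abs _ _
      _ ≤ ∑ i, ε * (|u.1 i| * (A i).frobenius) := by
          refine Finset.sum_le_sum fun i _ => ?_
          rw [← mul_sub, abs_mul]
          calc _ ≤ |u.1 i| * (ε * (A i).frobenius) :=
                mul_le_mul_of_nonneg_left (hv i) (abs_nonneg _)
            _ = _ := by ring
      _ ≤ ε * (√(∑ i, |u.1 i| ^ 2) * √(∑ i, (A i).frobenius ^ 2)) := by
          rw [← Finset.mul_sum]
          exact mul_le_mul_of_nonneg_left (Real.sum_mul_le_sqrt_mul_sqrt _ _ _) hε.le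
      _ = _ := by simp only [sq_abs, u.2, Real.sqrt_one, one_mul]
  | queryRes k x α u =>
    set s₁ := Request.load s (.queryRes k x α u) with hs₁
    have hk : s₁.nat 1 0 = k := by simp [hs₁, Request.load, Store.setRealArray]
    have hu : s₁.real 2 = vecArray u.1 := by simp [hs₁, Request.load, Store.setRealArray]
    have hx : s₁.real 3 = matArray x := by simp [hs₁, Request.load, Store.setRealArray]
    have hα : s₁.real 4 = matArray α := by simp [hs₁, Request.load, Store.setRealArray]
    have hl := hs.load (.queryRes k x α u)
    obtain ⟨M, out, h1, h2, h3⟩ := run_estimateThen hn hε hδ2 hS hl u hu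
      (post := subtractLowRank q) (tp := k * (n * 8 + 12) + 3)
      (Q := fun v s' => ∀ i : Fin n, s'.real 5 i =
        v i - ∑ j, α i j * (∑ a, x j a * u.1 a) ^ q)
      (fun s' hnat hreal => by
        have h := subtractLowRank_spec q s'
        rw [hnat 0 (by decide), hl.n_eq, hnat 1 (by decide), ← hs₁, hk] at h
        refine h.mono le_rfl fun s'' h'' i => ?_
        rw [h'' i i.2, hreal 2 (by decide) (by decide), hreal 3 (by decide) (by decide),
          hreal 4 (by decide) (by decide), ← hs₁, hu, hx, hα]
        simp only [Finset.sum_range, vecArray_apply, matArray_apply])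
      (by rintro a (rfl | rfl | rfl) <;> rfl) (by rintro a (rfl | rfl | rfl) <;> rfl)
    refine ⟨M, out, h1, h2, hmono (fun b hb => ?_) h3⟩
    rintro ⟨v, hv, hQ⟩
    refine hb fun i => ?_
    refine Approx.of_le hε.le (hD i) ?_
    simp only [Request.read, hQ]
    rw [Tensor.inner_sub_sum_smul]
    simp only [Tensor.inner_power_power]
    refine le_trans (le_of_eq ?_) (hv i)
    congr 1
    exact sub_sub_sub_cancel_right _ _ _

/-! ### Adaptive sequences of requests -/

theorem toOuterMeasure_uniform_map_le {M : ℕ} {β : Type*} (f : (Fin M → Bool) → β) (S : Set β)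
    {δ : ℝ} (h : ((f ⁻¹' S).ncard : ℝ) ≤ δ * 2 ^ M) :
    ((PMF.uniformOfFintype (Fin M → Bool)).map f).toOuterMeasure S ≤ ENNReal.ofReal δ := by
  classical
  rw [PMF.toOuterMeasure_map_apply, PMF.toOuterMeasure_uniformOfFintype_apply]
  refine ENNReal.div_le_of_le_mul ?_
  have hc : (Fintype.card (Fin M → Bool) : ENNReal) = ENNReal.ofReal (2 ^ M) := by
    rw [ENNReal.ofReal_pow (by norm_num)]
    simp
  rw [hc, ← ENNReal.ofReal_mul' (by positivity), ← Nat.card_eq_fintype_card,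
    Nat.card_coe_set_eq, ← ENNReal.ofReal_natCast]
  exact ENNReal.ofReal_le_ofReal h

theorem toOuterMeasure_bind_le {α β : Type*} (p : PMF α) (f : α → PMF β) (S : Set β)
    (r : ENNReal) (h : ∀ a ∈ p.support, (f a).toOuterMeasure S ≤ r) :
    (p.bind f).toOuterMeasure S ≤ r := by
  rw [PMF.toOuterMeasure_bind_apply]
  calc ∑' a, p a * (f a).toOuterMeasure S ≤ ∑' a, p a * r := by
        refine ENNReal.tsum_le_tsum fun a => ?_
        by_cases ha : p a = 0
        · simp [ha]
        · exact mul_le_mul_right (h a ((p.mem_support_iff a).2 ha)) _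
    _ = r := by rw [ENNReal.tsum_mul_right, p.tsum_coe, one_mul]

/-- The statement about adaptive adversaries, once the time bounds cover the numbers of steps. -/
theorem play_correct {n q : ℕ} {A : Fin n → Tensor n q} {ε δ : ℝ} {K m B : ℕ} (hn : 1 ≤ n)
    (hε : 0 < ε) (hδ2 : δ ≤ 1 / 2) (hS : Sizes n q ε δ K m B) {D : Fin n → ℝ} {Dtot : ℝ}
    (hD : ∀ i, (A i).frobenius ≤ D i) (hDtot : (Tensor.stack A : Tensor n (q + 1)).frobenius ≤ Dtot)
    {Tinit : ℕ} (hTinit : n * (n ^ q * 4 + 10) + K * 4 + m * 2 + B * 4 + 19 ≤ Tinit)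
    {T : Request n → ℕ} (hT : ∀ r : Request n, 4 * (m * q * B) + m * q * (B * 4 + n * 7 + 20) +
      n * (m * 7 + 10) + r.postTime + 12 ≤ T r) :
    HaltsWithin Tinit (samplingDataStructure q).init (initStore ε δ A) ∧
    ∀ (adv : Adversary n) (t : ℕ),
      (∀ z ∈ (play (samplingDataStructure q) ε δ A Tinit T adv t).support,
        HaltsWithin (T (adv z.1)) ((adv z.1).program (samplingDataStructure q))
          ((adv z.1).load z.2)) ∧
      (play (samplingDataStructure q) ε δ A Tinit T adv (t + 1)).toOuterMeasure
        (lastWrong (p := q + 1) A D Dtot ε) ≤ ENNReal.ofReal δ := by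
  obtain ⟨s₀, hs₀, T₀, hT₀, hrun₀⟩ := initProgram_spec hS A
  have hinit : run Tinit ([(samplingDataStructure q).init], initStore ε δ A) =
      PMF.pure ([], s₀) := by
    obtain ⟨N, rfl⟩ := Nat.exists_eq_add_of_le (hT₀.trans hTinit)
    rw [← run_nil N s₀]
    exact hrun₀ [] N
  have hready : ∀ (adv : Adversary n) (t : ℕ),
      ∀ z ∈ (play (samplingDataStructure q) ε δ A Tinit T adv t).support, Ready A ε m B z.2 := by
    intro adv t
    induction t with
    | zero =>
      intro z hz
      rw [play, execute, hinit, PMF.pure_map, PMF.pure_map, PMF.support_pure,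
        Set.mem_singleton_iff] at hz
      rw [hz]
      exact hs₀
    | succ t ih =>
      intro z hz
      rw [play, PMF.mem_support_bind_iff] at hz
      obtain ⟨y, hy, hz⟩ := hz
      obtain ⟨M, out, h1, h2, -⟩ := run_request hn hε hδ2 hS hD hDtot (ih y hy) (adv y.1)
      rw [execute, h2 _ (hT _), PMF.map_comp, PMF.map_comp, PMF.support_map] at hz
      obtain ⟨b, -, rfl⟩ := hz
      exact h1 b
  refine ⟨fun x hx => ?_, fun adv t => ⟨fun z hz x hx => ?_, ?_⟩⟩
  · rw [hinit, PMF.support_pure, Set.mem_singleton_iff] at hx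
    rw [hx]
  · obtain ⟨M, out, -, h2, -⟩ := run_request hn hε hδ2 hS hD hDtot (hready adv t z hz) (adv z.1)
    rw [h2 _ (hT _), PMF.support_map] at hx
    obtain ⟨b, -, rfl⟩ := hx
    rfl
  · rw [play]
    refine toOuterMeasure_bind_le _ _ _ _ fun z hz => ?_
    obtain ⟨M, out, -, h2, h3⟩ := run_request hn hε hδ2 hS hD hDtot (hready adv t z hz) (adv z.1)
    rw [execute, h2 _ (hT _), PMF.map_comp, PMF.map_comp]
    refine toOuterMeasure_uniform_map_le _ _ (le_trans (le_of_eq ?_) h3)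
    congr 2
    ext b
    simp only [lastWrong, Set.mem_preimage, Set.mem_ofPred_eq, Function.comp_apply,
      List.getLast?_concat, Option.mem_def, Option.some.injEq, exists_eq_left']

theorem mainTheorem5 (p : ℕ) (hp : 2 ≤ p) :
    ∃ (ds : DataStructure) (C : ℝ) (c : ℕ),
      ∀ (n : ℕ) (_ : 1 ≤ n) (ε δ : ℝ) (_ : 0 < ε) (_ : ε < 1) (_ : 0 < δ) (_ : δ ≤ 1 / 2)
        (A : Fin n → Tensor n (p - 1)) (D : Fin n → ℝ) (Dtot : ℝ)
        (_ : ∀ i, (A i).frobenius ≤ D i) (_ : (Tensor.stack A : Tensor n p).frobenius ≤ Dtot),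
        HaltsWithin (initTime C c p n ε δ) ds.init (initStore ε δ A) ∧
        ∀ (adv : Adversary n) (t : ℕ),
          (∀ z ∈ (play ds ε δ A (initTime C c p n ε δ) (Request.time C c p ε δ) adv t).support,
            HaltsWithin ((adv z.1).time C c p ε δ) ((adv z.1).program ds)
              ((adv z.1).load z.2)) ∧
          (play ds ε δ A (initTime C c p n ε δ) (Request.time C c p ε δ) adv (t + 1)).toOuterMeasure
            (lastWrong A D Dtot ε) ≤ ENNReal.ofReal δ := by
  obtain ⟨q, rfl⟩ : ∃ q, p = q + 1 := ⟨p - 1, by omega⟩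
  have hq : 1 ≤ q := by omega
  set c₀ : ℝ := 504 * (8 + 4 * Real.log (25 * q)) with hc₀
  have hc₀1 : 1 ≤ c₀ := by
    have : 0 ≤ Real.log (25 * q) := by
      refine Real.log_nonneg ?_
      have : (1 : ℝ) ≤ q := by exact_mod_cast hq
      linarith
    linarith
  refine ⟨samplingDataStructure q, (35 * q + 64) * c₀, 2, ?_⟩
  intro n hn ε δ hε hε1 hδ hδ2 A D Dtot hD hDtot
  obtain ⟨K, m, B, hS⟩ := exists_sizes n q hε hδ
  have hm := hS.m_pos hn hδ2
  have hKm : K ≤ m := by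
    have h1 := hS.le_m
    have h2 : (m : ℝ) * (ε / 5) ^ 2 ≤ m * 1 :=
      mul_le_mul_of_nonneg_left (pow_le_one₀ (by positivity) (by linarith)) (Nat.cast_nonneg m)
    rw [mul_one] at h2
    exact_mod_cast h1.trans h2
  -- All step counts are multiples of `g * m * (B + 1)` with `g` a power of `n`.
  have hbound : ∀ g : ℝ, (n : ℝ) ≤ g → (35 * q + 64) * (g * (m * (B + 1))) ≤
      softBound ((35 * q + 64) * c₀) 2 (ε⁻¹ ^ 2 * g * Real.log (1 / δ)) := by
    intro g hg
    have hg0 : 0 ≤ g := le_trans (Nat.cast_nonneg n) hg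
    have h := mul_le_mul_of_nonneg_left
      (mul_le_mul_of_nonneg_left (hS.mul_le hn hq hε hε1 hδ hδ2 hg) hg0)
      (show (0 : ℝ) ≤ 35 * q + 64 by positivity)
    refine h.trans (le_of_eq ?_)
    rw [softBound, ← hc₀]
    ring
  have hnq : (n : ℝ) ≤ (n : ℝ) ^ q := by
    exact_mod_cast Nat.le_self_pow (by omega) n
  have hnq1 : (n : ℝ) ≤ (n : ℝ) ^ (q + 1) := by
    exact_mod_cast Nat.le_self_pow (by omega) n
  have hpost : ∀ x : ℕ, x ≤ n * 4 + 7 → 4 * (m * q * B) + m * q * (B * 4 + n * 7 + 20) +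
      n * (m * 7 + 10) + x + 12 ≤ (35 * q + 64) * (n * (m * (B + 1))) := by
    intro x hx
    have h1 : m * B ≤ n * (m * B) := Nat.le_mul_of_pos_left _ hn
    have h2 : m ≤ n * m := Nat.le_mul_of_pos_left _ hn
    have h3 : n ≤ n * m := Nat.le_mul_of_pos_right _ hm
    have h4 : q * (m * B) ≤ q * (n * (m * B)) := Nat.mul_le_mul_left _ h1
    have h5 : q * m ≤ q * (n * m) := Nat.mul_le_mul_left _ h2
    ring_nf at *
    nlinarith [Nat.zero_le (q * (n * (m * B))), Nat.zero_le (n * (m * B))]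
  have hmain : ∀ x : ℕ, x ≤ n * 4 + 7 → ((4 * (m * q * B) + m * q * (B * 4 + n * 7 + 20) +
      n * (m * 7 + 10) + x + 12 : ℕ) : ℝ) ≤
      softBound ((35 * q + 64) * c₀) 2 (ε⁻¹ ^ 2 * (n : ℝ) ^ q * Real.log (1 / δ)) := by
    intro x hx
    refine le_trans ?_ (hbound _ hnq)
    refine (Nat.cast_le.2 (hpost x hx)).trans ?_
    push_cast
    gcongr
  refine play_correct hn hε hδ2 hS hD hDtot (Nat.le_floor ?_) ?_
  · refine le_trans ?_ (hbound _ hnq1)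
    have h : n * (n ^ q * 4 + 10) + K * 4 + m * 2 + B * 4 + 19 ≤
        (35 * q + 64) * (n ^ (q + 1) * (m * (B + 1))) := by
      have hg : n ≤ n ^ (q + 1) := Nat.le_self_pow (by omega) n
      have hg1 : 1 ≤ n ^ (q + 1) := hn.trans hg
      have e : n * (n ^ q * 4 + 10) = 4 * n ^ (q + 1) + 10 * n := by ring
      rw [e]
      generalize n ^ (q + 1) = g at *
      have h1 : m * (B + 1) ≤ g * (m * (B + 1)) := Nat.le_mul_of_pos_left _ hg1
      have h2 : g ≤ g * (m * (B + 1)) := Nat.le_mul_of_pos_right _ (by positivity)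
      have h3 : m ≤ m * (B + 1) := Nat.le_mul_of_pos_right _ (by omega)
      have h4 : B + 1 ≤ m * (B + 1) := Nat.le_mul_of_pos_left _ hm
      calc _ ≤ 64 * (g * (m * (B + 1))) := by omega
        _ ≤ _ := Nat.mul_le_mul_right _ (by omega)
    exact_mod_cast h
  · intro r
    cases r with
    | query u => exact Nat.le_floor (hmain 1 (by omega))
    | queryValue u => exact Nat.le_floor (hmain _ le_rfl)
    | queryRes k x α u =>
      refine Nat.le_floor ?_
      have h := hmain 3 (by omega)
      have hk : ((k * (n * 8 + 12) : ℕ) : ℝ) ≤ (35 * q + 64) * c₀ * ((n : ℝ) ^ 2 * k) := by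
        have h1 : k * (n * 8 + 12) ≤ 20 * (n ^ 2 * k) := by
          have h2 : n ≤ n ^ 2 := Nat.le_self_pow two_ne_zero n
          calc k * (n * 8 + 12) ≤ k * (20 * n ^ 2) := Nat.mul_le_mul_left _ (by omega)
            _ = _ := by ring
        have h2 : ((k * (n * 8 + 12) : ℕ) : ℝ) ≤ 20 * ((n : ℝ) ^ 2 * k) := by exact_mod_cast h1
        refine h2.trans (mul_le_mul_of_nonneg_right ?_ (by positivity))
        have : (0 : ℝ) ≤ q := Nat.cast_nonneg q
        nlinarith
      refine le_trans (le_of_eq ?_) (add_le_add h hk)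
      simp only [Request.postTime]
      push_cast
      ring
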